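/- Graphs are finite, undirected, without multiple edges, loops being allowed. For a set $V$ let $\mathbb Z_2^{*V}$ be the free product of copies of $\mathbb Z_2$ indexed by $V$, with generators $g_v$ ($v\in V$); for a word $\mathbf a=a_1\cdots a_k$ over $V$ put $g_{\mathbf a}=g_{a_1}\cdots g_{a_k}$. A map $\phi\colon V\to W$ induces a homomorphism $\phi\colon\mathbb Z_2^{*V}\to\mathbb Z_2^{*W}$, $g_v\mapsto g_{\phi(v)}$. For graphs $K,H$ and an injective partial function $f\colon V(K)\to V(H)$, let $K\cup_f H$ be the quotient of $K\sqcup H$ identifying $v$ with $f(v)$ whenever $f(v)$ is defined, and let $f_K,f_H$ be the canonical maps of $V(K),V(H)$ into $V(K\cup_f H)$. For a partition $\pi$ of $V(K)$ let $q_\pi\colon K\to K/\pi$ be the quotient map. An *easy graph fibration* $F$ is a set of pairs $(K,a)$, up to isomorphism, where $K$ is a graph and $a\in\mathbb Z_2^{*V(K)}$, such that, with $F(K)=\{a\mid (K,a)\in F\}$: the identity belongs to $F(N_0)$ and to $F(N_1)$, where $N_k$ is the edgeless graph on $k$ vertices; each $F(K)$ is empty or a normal subgroup of $\mathbb Z_2^{*V(K)}$;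 if $a\in F(K)$ and $b\in F(H)$, then $f_K(a)f_H(b)\in F(K\cup_f H)$ for all $f$; and $q_\pi(F(K))\subseteq F(K/\pi)$ for all $K$ and $\pi$. We write $G\in F$ if $F(G)\neq\emptyset$. The *group-theoretical graph category associated to* $F$ is the collection $\mathscr C$ of sets $$\mathscr C(k,l)=\{(K,\mathbf a,\mathbf b)\mid \mathbf a\in V(K)^k,\ \mathbf b\in V(K)^l,\ g_{\mathbf a}^{-1}g_{\mathbf b}\in F(K)\}.$$ For a graph $G$ and $\mathbf K=(K,\mathbf a,\mathbf b)\in\mathscr C(k,l)$ let $T^G_{\mathbf K}\colon(\mathbb C^{V(G)})^{\otimes k}\to(\mathbb C^{V(G)})^{\otimes l}$ be the linear map whose $(\mathbf j,\mathbf i)$ entry is the number of graph homomorphisms $\phi\colon K\to G$ with $\phi(\mathbf a)=\mathbf i$ and $\phi(\mathbf b)=\mathbf j$. An *orthogonal compact matrix quantum group* is a pair $(A,u)$ of a unital complex $*$-algebra $A$ and a matrix $u$ over $A$, indexed by a finite set, whose entries are self-adjoint and generate $A$, with $uu^t=1=u^tu$, such that there is a $*$-homomorphism $\Delta\colon A\to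 A\otimes A$ with $\Delta(u_{ij})=\sum_k u_{ik}\otimes u_{kj}$. Two such pairs are equal if a $*$-isomorphism carries the first matrix to the second entrywise. The quantum group $\mathbb G$ associated to $\mathscr C$ and $G$ is the orthogonal compact matrix quantum group with fundamental representation $u=(u_{ij})_{i,j\in V(G)}$ such that, for all $k,l\ge 0$, $$\{T\mid Tu^{\otimes k}=u^{\otimes l}T\}=\operatorname{span}\{T^G_{\mathbf K}\mid\mathbf K\in\mathscr C(k,l)\};$$ explicitly, its $*$-algebra $O(\mathbb G)$ is the universal unital $*$-algebra generated by self-adjoint elements $u_{ij}$, $i,j\in V(G)$, subject to the relations $T^G_{\mathbf K}u^{\otimes k}=u^{\otimes l}T^G_{\mathbf K}$ for all $\mathbf K\in\mathscr C(k,l)$ and all $k,l\geq 0$. **Theorem.** Let $F$ be an easy graph fibration, $G\in F$, and $\Gamma=\mathbb Z_2^{*V(G)}/F(G)$. Let $\hat\Gamma\rtimes\operatorname{Aut}G$ be the pair consisting of $\mathbb C\Gamma\otimes O(\operatorname{Aut}G)$, where $O(\operatorname{Aut} G)$ is the algebra of functions $\operatorname{Aut}G\to\mathbb C$, and of the matrix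 with entries $\gamma_i v_{ij}$, $i,j\in V(G)$, where $\gamma_i\in\mathbb C\Gamma$ is the class of the generator $g_i$ and $v_{ij}(\sigma)=\delta_{i\sigma(j)}$. Then $$\mathbb G=\hat\Gamma\rtimes\operatorname{Aut}G .$$ That is, $\hat\Gamma\rtimes\operatorname{Aut}G$ is an orthogonal compact matrix quantum group whose intertwiner spaces are $\operatorname{span}\{T^G_{\mathbf K}\mid\mathbf K\in\mathscr C(k,l)\}$, and there is a $*$-isomorphism $O(\mathbb G)\to\mathbb C\Gamma\otimes O(\operatorname{Aut}G)$ with $u_{ij}\mapsto\gamma_iv_{ij}$ for all $i,j$. -/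

import Mathlib

open scoped TensorProduct

noncomputable section

/-! ## Finite graphs with loops -/

/-- A finite undirected graph without multiple edges, loops being allowed. -/
structure LoopGraph where
  V : Type
  finite : Finite V
  Adj : V → V → Prop
  symm : ∀ x y, Adj x y → Adj y x

namespace LoopGraph

instance (K : LoopGraph) : Finite K.V := K.finite

instance (K : LoopGraph) : Fintype K.V := Fintype.ofFinite _

instance (K : LoopGraph) : DecidableEq K.V := Classical.decEq _

/-- Graph homomorphisms. -/
abbrev Hom (K H : LoopGraph) : Type := K.Adj →r H.Adj

/-- Graph isomorphisms. -/
abbrev Iso (K H : LoopGraph) : Type := K.Adj ≃r H.Adj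

/-- The edgeless graph on `k` vertices. -/
def edgeless (k : ℕ) : LoopGraph where
  V := Fin k
  finite := inferInstance
  Adj _ _ := False
  symm _ _ h := h

/-- The disjoint union of two graphs. -/
def disjUnion (K H : LoopGraph) : LoopGraph where
  V := K.V ⊕ H.V
  finite := inferInstance
  Adj := Sum.LiftRel K.Adj H.Adj
  symm := by
    rintro _ _ (h | h)
    · exact Sum.LiftRel.inl (K.symm _ _ h)
    · exact Sum.LiftRel.inr (H.symm _ _ h)

/-- The inclusion of the first graph into the disjoint union, on vertices. -/
def inl (K H : LoopGraph) (x : K.V) : (K.disjUnion H).V := Sum.inl x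

/-- The inclusion of the second graph into the disjoint union, on vertices. -/
def inr (K H : LoopGraph) (y : H.V) : (K.disjUnion H).V := Sum.inr y

/-- The quotient graph by a partition of the vertex set (given as an equivalence relation): two
blocks are adjacent when some of their elements are. -/
def quot (K : LoopGraph) (π : Setoid K.V) : LoopGraph where
  V := Quotient π
  finite := inferInstance
  Adj p q := ∃ x y, Quotient.mk π x = p ∧ Quotient.mk π y = q ∧ K.Adj x y
  symm := by
    rintro _ _ ⟨x, y, hx, hy, h⟩
    exact ⟨y, x, hy, hx, K.symm _ _ h⟩

/-- The partition of `V(K) ⊔ V(H)` generated by a relation between `V(K)` and `V(H)`. -/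
def glueSetoid (K H : LoopGraph) (r : K.V → H.V → Prop) : Setoid (K.disjUnion H).V :=
  Relation.EqvGen.setoid fun p q => ∃ x y, r x y ∧ p = K.inl H x ∧ q = K.inr H y

/-- The graph obtained from the disjoint union by identifying all related pairs of vertices. -/
def glue (K H : LoopGraph) (r : K.V → H.V → Prop) : LoopGraph :=
  (K.disjUnion H).quot (K.glueSetoid H r)

/-- The canonical map of the first vertex set into the glued graph. -/
def glueLeft (K H : LoopGraph) (r : K.V → H.V → Prop) (x : K.V) : (K.glue H r).V :=
  Quotient.mk (K.glueSetoid H r) (K.inl H x)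

/-- The canonical map of the second vertex set into the glued graph. -/
def glueRight (K H : LoopGraph) (r : K.V → H.V → Prop) (y : H.V) : (K.glue H r).V :=
  Quotient.mk (K.glueSetoid H r) (K.inr H y)

/-- A vertex overlap of `K` and `H`: an injective partial function `V(K) → V(H)`. -/
abbrev Overlap (K H : LoopGraph) : Type := K.V ≃. H.V

/-- The graph of an overlap, as a relation. -/
def Overlap.rel {K H : LoopGraph} (f : Overlap K H) (x : K.V) (y : H.V) : Prop := y ∈ f x

/-- The `f`-union of two graphs. -/
def overlapUnion (K H : LoopGraph) (f : Overlap K H) : LoopGraph := K.glue H f.rel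

/-- The automorphism group of a graph, as a group of permutations of its vertices. -/
def autGroup (G : LoopGraph) : Subgroup (Equiv.Perm G.V) where
  carrier := {σ | ∀ x y, G.Adj (σ x) (σ y) ↔ G.Adj x y}
  mul_mem' {σ τ} hσ hτ x y := (hσ (τ x) (τ y)).trans (hτ x y)
  one_mem' _ _ := Iff.rfl
  inv_mem' {σ} hσ x y := by
    have h := hσ (σ⁻¹ x) (σ⁻¹ y)
    simpa using h.symm

end LoopGraph

/-! ## The free product `ℤ₂^{*V}` -/

/-- The free product of copies of `ℤ₂` indexed by `V`. -/
abbrev FreeZ2 (V : Type) : Type := Monoid.CoprodI fun _ : V => Multiplicative (ZMod 2)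

namespace FreeZ2

/-- The generator of the factor indexed by `v`. -/
def gen {V : Type} (v : V) : FreeZ2 V :=
  Monoid.CoprodI.of (M := fun _ : V => Multiplicative (ZMod 2)) (i := v) (Multiplicative.ofAdd 1)

/-- The group homomorphism induced by a map of index sets. -/
def map {V W : Type} (φ : V → W) : FreeZ2 V →* FreeZ2 W :=
  Monoid.CoprodI.lift fun v =>
    Monoid.CoprodI.of (M := fun _ : W => Multiplicative (ZMod 2)) (i := φ v)

/-- The group element represented by a word. -/
def word {V : Type} {k : ℕ} (a : Fin k → V) : FreeZ2 V := (List.ofFn fun m => gen (a m)).prod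

theorem gen_mul_self {V : Type} (v : V) : gen v * gen v = 1 := by
  rw [gen, ← map_mul]
  have h : (Multiplicative.ofAdd (1 : ZMod 2)) * Multiplicative.ofAdd 1 = 1 := by decide
  rw [h, map_one]

theorem map_gen {V W : Type} (φ : V → W) (v : V) : map φ (gen v) = gen (φ v) := by
  simp [map, gen]

theorem map_word {V W : Type} {k : ℕ} (φ : V → W) (a : Fin k → V) :
    map φ (word a) = word (φ ∘ a) := by
  rw [word, map_list_prod, List.map_ofFn, word]
  simp [Function.comp_def, map_gen]

theorem map_map {V W X : Type} (φ : V → W) (ψ : W → X) (g : FreeZ2 V) :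
    map ψ (map φ g) = map (ψ ∘ φ) g := by
  have h : (map ψ).comp (map φ) = map (ψ ∘ φ) := by
    apply Monoid.CoprodI.ext_hom
    intro i
    ext x
    simp [map]
  exact DFunLike.congr_fun h g

theorem word_append {V : Type} {k l : ℕ} (a : Fin k → V) (b : Fin l → V) :
    word (Fin.append a b) = word a * word b := by
  have h : (fun m => gen (Fin.append a b m)) =
      Fin.append (fun m => gen (a m)) (fun m => gen (b m)) := by
    funext m
    refine Fin.addCases (fun i => ?_) (fun i => ?_) m <;> simp
  rw [word, h, List.ofFn_fin_append, List.prod_append, word, word]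

end FreeZ2

/-! ## Graph fibrations -/

/-- A graph fibration: a set of pairs `(K, a)` with `a ∈ ℤ₂^{*V(K)}`, invariant under graph
isomorphism. The set is given by its fibres `F(K) = {a | (K, a) ∈ F}`. -/
structure GraphFibration where
  fibre : (K : LoopGraph) → Set (FreeZ2 K.V)
  /-- Pairs are taken up to isomorphism; for `K = H` this is invariance under automorphisms. -/
  iso_mem : ∀ {K H : LoopGraph} (φ : K.Iso H) {a : FreeZ2 K.V},
    a ∈ fibre K → FreeZ2.map φ a ∈ fibre H
  null_mem : 1 ∈ fibre (LoopGraph.edgeless 0)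
  vertex_mem : 1 ∈ fibre (LoopGraph.edgeless 1)
  /-- Each fibre is empty or a normal subgroup. -/
  normal_fibre : ∀ K, (fibre K).Nonempty →
    ∃ N : Subgroup (FreeZ2 K.V), N.Normal ∧ (N : Set (FreeZ2 K.V)) = fibre K
  /-- Closure under overlapping unions. -/
  union_mem : ∀ {K H : LoopGraph} (f : LoopGraph.Overlap K H) {a : FreeZ2 K.V} {b : FreeZ2 H.V},
    a ∈ fibre K → b ∈ fibre H →
      FreeZ2.map (K.glueLeft H f.rel) a * FreeZ2.map (K.glueRight H f.rel) b ∈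
        fibre (K.overlapUnion H f)

namespace GraphFibration

/-- `K ∈ F`: the fibre over `K` is not empty. -/
def Mem (F : GraphFibration) (K : LoopGraph) : Prop := (F.fibre K).Nonempty

/-- A graph fibration is easy when it is closed under quotients. -/
def IsEasy (F : GraphFibration) : Prop :=
  ∀ (K : LoopGraph) (π : Setoid K.V), ∀ a ∈ F.fibre K,
    FreeZ2.map (Quotient.mk π) a ∈ F.fibre (K.quot π)

/-- A non-empty fibre, as a subgroup. -/
def fibreSubgroup (F : GraphFibration) (K : LoopGraph) (hK : F.Mem K) :
    Subgroup (FreeZ2 K.V) where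
  carrier := F.fibre K
  mul_mem' := by
    obtain ⟨N, _, h⟩ := F.normal_fibre K hK
    rw [← h]; exact N.mul_mem
  one_mem' := by
    obtain ⟨N, _, h⟩ := F.normal_fibre K hK
    rw [← h]; exact N.one_mem
  inv_mem' := by
    obtain ⟨N, _, h⟩ := F.normal_fibre K hK
    rw [← h]; exact N.inv_mem

theorem conj_mem (F : GraphFibration) {K : LoopGraph} {a : FreeZ2 K.V} (ha : a ∈ F.fibre K)
    (g : FreeZ2 K.V) : g * a * g⁻¹ ∈ F.fibre K := by
  obtain ⟨N, hN, h⟩ := F.normal_fibre K ⟨a, ha⟩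
  rw [← h] at ha ⊢
  exact hN.conj_mem a ha g

instance (F : GraphFibration) (K : LoopGraph) (hK : F.Mem K) : (F.fibreSubgroup K hK).Normal where
  conj_mem _ ha g := F.conj_mem ha g

end GraphFibration

/-! ## Bilabelled graphs and graph categories -/

/-- A bilabelled graph with `k` input and `l` output vertices. -/
structure BilabelledGraph (k l : ℕ) extends LoopGraph where
  inp : Fin k → V
  out : Fin l → V

namespace BilabelledGraph

/-- The one-vertex graph (without loop) with `k` inputs and `l` outputs. -/
def point (k l : ℕ) : BilabelledGraph k l where
  toLoopGraph := LoopGraph.edgeless 1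
  inp _ := (0 : Fin 1)
  out _ := (0 : Fin 1)

/-- The null graph without inputs and outputs. -/
def null : BilabelledGraph 0 0 where
  toLoopGraph := LoopGraph.edgeless 0
  inp i := i.elim0
  out i := i.elim0

/-- The tensor product: disjoint union with concatenated labels. -/
def tensor {k l k' l' : ℕ} (K : BilabelledGraph k l) (H : BilabelledGraph k' l') :
    BilabelledGraph (k + k') (l + l') where
  toLoopGraph := K.toLoopGraph.disjUnion H.toLoopGraph
  inp := Fin.append (K.toLoopGraph.inl H.toLoopGraph ∘ K.inp) (K.toLoopGraph.inr H.toLoopGraph ∘ H.inp)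
  out := Fin.append (K.toLoopGraph.inl H.toLoopGraph ∘ K.out) (K.toLoopGraph.inr H.toLoopGraph ∘ H.out)

/-- The relation identifying the `i`-th output of `K` with the `i`-th input of `H`. -/
def matching {k l m : ℕ} (K : BilabelledGraph k l) (H : BilabelledGraph l m)
    (x : K.V) (y : H.V) : Prop := ∃ i, x = K.out i ∧ y = H.inp i

/-- The composition `H · K`. -/
def comp {k l m : ℕ} (H : BilabelledGraph l m) (K : BilabelledGraph k l) :
    BilabelledGraph k m where
  toLoopGraph := K.toLoopGraph.glue H.toLoopGraph (K.matching H)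
  inp i := K.toLoopGraph.glueLeft H.toLoopGraph (K.matching H) (K.inp i)
  out i := K.toLoopGraph.glueRight H.toLoopGraph (K.matching H) (H.out i)

/-- The involution: inputs and outputs are exchanged. -/
def invol {k l : ℕ} (K : BilabelledGraph k l) : BilabelledGraph l k where
  toLoopGraph := K.toLoopGraph
  inp := K.out
  out := K.inp

/-- The quotient of a bilabelled graph by a partition of its vertices. -/
def quot {k l : ℕ} (K : BilabelledGraph k l) (π : Setoid K.V) : BilabelledGraph k l where
  toLoopGraph := K.toLoopGraph.quot π
  inp i := Quotient.mk π (K.inp i)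
  out i := Quotient.mk π (K.out i)

end BilabelledGraph

/-- A graph category: an isomorphism-invariant collection of bilabelled graphs containing the
identity, the duality morphism and the scalar identity, and closed under tensor products,
compositions and the involution. -/
structure GraphCategory where
  mor : (k l : ℕ) → Set (BilabelledGraph k l)
  iso_mem : ∀ {k l : ℕ} {K H : BilabelledGraph k l} (φ : K.toLoopGraph.Iso H.toLoopGraph),
    (∀ i, φ (K.inp i) = H.inp i) → (∀ j, φ (K.out j) = H.out j) → K ∈ mor k l → H ∈ mor k l
  id_mem : BilabelledGraph.point 1 1 ∈ mor 1 1
  pair_mem : BilabelledGraph.point 0 2 ∈ mor 0 2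
  null_mem : BilabelledGraph.null ∈ mor 0 0
  tensor_mem : ∀ {k l k' l' : ℕ} {K : BilabelledGraph k l} {H : BilabelledGraph k' l'},
    K ∈ mor k l → H ∈ mor k' l' → K.tensor H ∈ mor (k + k') (l + l')
  comp_mem : ∀ {k l m : ℕ} {K : BilabelledGraph k l} {H : BilabelledGraph l m},
    K ∈ mor k l → H ∈ mor l m → H.comp K ∈ mor k m
  invol_mem : ∀ {k l : ℕ} {K : BilabelledGraph k l}, K ∈ mor k l → K.invol ∈ mor l k

/-- A group-theoretical graph category: a graph category closed under graph quotients. -/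
structure GroupTheoreticalGraphCategory extends GraphCategory where
  quot_mem : ∀ {k l : ℕ} {K : BilabelledGraph k l} (π : Setoid K.V),
    K ∈ mor k l → K.quot π ∈ mor k l

namespace GraphFibration

/-- The set of bilabelled graphs `(K, a, b)` with `(K, g_a⁻¹ g_b) ∈ F`. -/
def categorySet (F : GraphFibration) (k l : ℕ) : Set (BilabelledGraph k l) :=
  {K | (FreeZ2.word K.inp)⁻¹ * FreeZ2.word K.out ∈ F.fibre K.toLoopGraph}

theorem eqvGen_false_iff {α : Type} {r : α → α → Prop} (hr : ∀ x y, ¬ r x y) {x y : α} :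
    Relation.EqvGen r x y ↔ x = y := by
  constructor
  · intro h
    induction h with
    | rel x y h => exact (hr x y h).elim
    | refl => rfl
    | symm _ _ _ ih => exact ih.symm
    | trans _ _ _ _ _ ih₁ ih₂ => exact ih₁.trans ih₂
  · rintro rfl
    exact Relation.EqvGen.refl _

/-- The disjoint union is the union along the empty overlap. -/
def botUnionIso (K H : LoopGraph) :
    (K.overlapUnion H (⊥ : LoopGraph.Overlap K H)).Iso (K.disjUnion H) :=
  have key : ∀ p q : (K.disjUnion H).V,
      (K.glueSetoid H (LoopGraph.Overlap.rel (⊥ : LoopGraph.Overlap K H))) p q ↔ p = q := by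
    intro p q
    refine eqvGen_false_iff ?_
    rintro _ _ ⟨x, y, h, -, -⟩
    simp [LoopGraph.Overlap.rel] at h
  { toFun := fun p => Quotient.liftOn p id fun a b h => (key a b).1 h
    invFun := fun p => Quotient.mk _ p
    left_inv := by rintro ⟨p⟩; rfl
    right_inv := fun _ => rfl
    map_rel_iff' := by
      rintro ⟨p⟩ ⟨q⟩
      constructor
      · intro h
        exact ⟨p, q, rfl, rfl, h⟩
      · rintro ⟨x, y, hx, hy, h⟩
        have hx' := (key _ _).1 (Quotient.exact hx)
        have hy' := (key _ _).1 (Quotient.exact hy)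
        subst hx' hy'
        exact h }

theorem disjUnion_mem (F : GraphFibration) {K H : LoopGraph} {a : FreeZ2 K.V} {b : FreeZ2 H.V}
    (ha : a ∈ F.fibre K) (hb : b ∈ F.fibre H) :
    FreeZ2.map (K.inl H) a * FreeZ2.map (K.inr H) b ∈ F.fibre (K.disjUnion H) := by
  have h := F.iso_mem (botUnionIso K H) (F.union_mem ⊥ ha hb)
  have e := map_mul (FreeZ2.map (botUnionIso K H))
    (FreeZ2.map (K.glueLeft H (LoopGraph.Overlap.rel ⊥)) a)
    (FreeZ2.map (K.glueRight H (LoopGraph.Overlap.rel ⊥)) b)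
  have e₁ := FreeZ2.map_map (K.glueLeft H (LoopGraph.Overlap.rel ⊥)) (botUnionIso K H) a
  have e₂ := FreeZ2.map_map (K.glueRight H (LoopGraph.Overlap.rel ⊥)) (botUnionIso K H) b
  have e₃ := e.trans (congrArg₂ (· * ·) e₁ e₂)
  exact Set.mem_of_eq_of_mem e₃.symm h

theorem tensor_aux {Γ : Type} [Group Γ] (a b c d : Γ) :
    (a * c)⁻¹ * (b * d) = c⁻¹ * (a⁻¹ * b * (d * c⁻¹)) * c⁻¹⁻¹ := by
  simp [mul_assoc]

/-- The group-theoretical graph category associated to an easy graph fibration. -/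
def category (F : GraphFibration) (hF : F.IsEasy) : GroupTheoreticalGraphCategory where
  mor := F.categorySet
  iso_mem := by
    intro k l K H φ hi ho hK
    have h := F.iso_mem φ hK
    rw [map_mul, map_inv, FreeZ2.map_word, FreeZ2.map_word] at h
    rwa [show (φ ∘ K.inp) = H.inp from funext hi, show (φ ∘ K.out) = H.out from funext ho] at h
  id_mem := by
    change (FreeZ2.word _)⁻¹ * FreeZ2.word _ ∈ F.fibre (LoopGraph.edgeless 1)
    convert F.vertex_mem
    exact inv_mul_cancel _
  pair_mem := by
    change (FreeZ2.word _)⁻¹ * FreeZ2.word _ ∈ F.fibre (LoopGraph.edgeless 1)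
    convert F.vertex_mem
    have h₀ : FreeZ2.word (BilabelledGraph.point 0 2).inp = 1 := by simp [FreeZ2.word]
    have h₂ : FreeZ2.word (BilabelledGraph.point 0 2).out = 1 := by
      have h := FreeZ2.gen_mul_self ((BilabelledGraph.point 0 2).out 0)
      rw [← h]
      simp only [FreeZ2.word, List.ofFn_succ, List.ofFn_zero, List.prod_nil, List.prod_cons,
        mul_one]
      rfl
    exact (congrArg₂ (fun x y => x⁻¹ * y) h₀ h₂).trans (inv_mul_cancel 1)
  null_mem := by
    change (FreeZ2.word _)⁻¹ * FreeZ2.word _ ∈ F.fibre (LoopGraph.edgeless 0)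
    convert F.null_mem
    exact inv_mul_cancel _
  tensor_mem := by
    intro k l k' l' K H hK hH
    have hc := F.conj_mem hH (FreeZ2.word H.inp)
    rw [mul_inv_cancel_left] at hc
    have h := F.disjUnion_mem hK hc
    have hn := F.conj_mem h
      (FreeZ2.map (K.toLoopGraph.inr H.toLoopGraph) (FreeZ2.word H.inp))⁻¹
    simp only [map_mul, map_inv, FreeZ2.map_word] at hn
    have ei := FreeZ2.word_append (K.toLoopGraph.inl H.toLoopGraph ∘ K.inp)
      (K.toLoopGraph.inr H.toLoopGraph ∘ H.inp)
    have eo := FreeZ2.word_append (K.toLoopGraph.inl H.toLoopGraph ∘ K.out)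
      (K.toLoopGraph.inr H.toLoopGraph ∘ H.out)
    change (FreeZ2.word _)⁻¹ * FreeZ2.word _ ∈ F.fibre _
    exact Set.mem_of_eq_of_mem
      ((congrArg₂ (fun x y => x⁻¹ * y) ei eo).trans (tensor_aux _ _ _ _)) hn
  comp_mem := by
    intro k l m K H hK hH
    have h := F.disjUnion_mem hK hH
    have hq := hF _ (K.toLoopGraph.glueSetoid H.toLoopGraph (K.matching H)) _ h
    have e : Quotient.mk (K.toLoopGraph.glueSetoid H.toLoopGraph (K.matching H)) ∘
        (K.toLoopGraph.inl H.toLoopGraph ∘ K.out) =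
        Quotient.mk (K.toLoopGraph.glueSetoid H.toLoopGraph (K.matching H)) ∘
        (K.toLoopGraph.inr H.toLoopGraph ∘ H.inp) := by
      funext i
      exact Quotient.sound (Relation.EqvGen.rel _ _ ⟨K.out i, H.inp i, ⟨i, rfl, rfl⟩, rfl, rfl⟩)
    simp only [map_mul, map_inv, FreeZ2.map_word, e] at hq
    rw [mul_assoc, mul_inv_cancel_left] at hq
    exact hq
  invol_mem := by
    intro k l K hK
    have h := (F.fibreSubgroup _ ⟨_, hK⟩).inv_mem hK
    rw [mul_inv_rev, inv_inv] at h
    exact h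
  quot_mem := by
    intro k l K π hK
    have h := hF _ π _ hK
    rw [map_mul, map_inv, FreeZ2.map_word, FreeZ2.map_word] at h
    exact h

end GraphFibration

/-! ## The functor `T^G` -/

/-- The matrix of `T^G_K : (ℂ^{V(G)})^{⊗k} → (ℂ^{V(G)})^{⊗l}`: the entry at `(j, i)` is the number
of homomorphisms `φ : K → G` with `φ(a) = i` and `φ(b) = j`. -/
def homMatrix (G : LoopGraph) {k l : ℕ} (K : BilabelledGraph k l) :
    Matrix (Fin l → G.V) (Fin k → G.V) ℂ :=
  Matrix.of fun j i =>
    (Nat.card {φ : K.toLoopGraph.Hom G // (∀ m, φ (K.inp m) = i m) ∧ ∀ m, φ (K.out m) = j m} : ℂ)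

/-- The image of the morphisms `k → l` of a graph category under `T^G`. -/
def homMatrices (G : LoopGraph) (C : GraphCategory) (k l : ℕ) :
    Set (Matrix (Fin l → G.V) (Fin k → G.V) ℂ) :=
  {T | ∃ K ∈ C.mor k l, T = homMatrix G K}

/-! ## Compact matrix quantum groups -/

section QuantumGroups

variable {V A : Type} [Fintype V] [DecidableEq V] [Ring A] [Algebra ℂ A]

/-- The tensor power `u^{⊗k}` with entries `u_{i₁j₁} ⋯ u_{i_kj_k}`. -/
def tensorPow (u : Matrix V V A) (k : ℕ) : Matrix (Fin k → V) (Fin k → V) A :=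
  Matrix.of fun i j => (List.ofFn fun m => u (i m) (j m)).prod

/-- `Mor(u^{⊗k}, u^{⊗l})`: the matrices `T` with `T u^{⊗k} = u^{⊗l} T`. -/
def intertwiners (u : Matrix V V A) (k l : ℕ) : Set (Matrix (Fin l → V) (Fin k → V) ℂ) :=
  {T | T.map (algebraMap ℂ A) * tensorPow u k = tensorPow u l * T.map (algebraMap ℂ A)}

/-- `(A, u)` is an orthogonal compact matrix quantum group. -/
structure IsOrthogonalCMQG [StarRing A] [StarModule ℂ A] (u : Matrix V V A) : Prop where
  generates : StarAlgebra.adjoin ℂ (Set.range fun p : V × V => u p.1 p.2) = ⊤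
  selfAdjoint : ∀ i j, star (u i j) = u i j
  mul_transpose : u * u.transpose = 1
  transpose_mul : u.transpose * u = 1
  comul : ∃ Δ : A →⋆ₐ[ℂ] A ⊗[ℂ] A, ∀ i j, Δ (u i j) = ∑ k, u i k ⊗ₜ[ℂ] u k j

/-- `(A, u)` is an orthogonal compact matrix quantum group associated to the graph `G` and the graph
category `C`: the intertwiner spaces are spanned by the maps `T^G_K`. -/
def IsAssociatedCMQG (G : LoopGraph) (C : GraphCategory) [StarRing A] [StarModule ℂ A]
    (u : Matrix G.V G.V A) : Prop :=
  IsOrthogonalCMQG u ∧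
    ∀ k l, intertwiners u k l = (Submodule.span ℂ (homMatrices G C k l) : Set _)

end QuantumGroups

/-! ## Monoid algebras as `*`-algebras -/

/-- The conjugate-linear extension of a map of monoids to the monoid algebras. -/
def monoidAlgebraStar {M : Type} (s : M → M) (x : MonoidAlgebra ℂ M) : MonoidAlgebra ℂ M :=
  MonoidAlgebra.map (starRingEnd ℂ).toAddMonoidHom (MonoidAlgebra.mapDomain s x)

theorem monoidAlgebraStar_single {M : Type} (s : M → M) (m : M) (c : ℂ) :
    monoidAlgebraStar s (MonoidAlgebra.single m c) = MonoidAlgebra.single (s m) (star c) := by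
  rw [monoidAlgebraStar, MonoidAlgebra.mapDomain_single, MonoidAlgebra.map_single]
  rfl

theorem monoidAlgebraStar_add {M : Type} (s : M → M) (x y : MonoidAlgebra ℂ M) :
    monoidAlgebraStar s (x + y) = monoidAlgebraStar s x + monoidAlgebraStar s y := by
  rw [monoidAlgebraStar, MonoidAlgebra.mapDomain_add, MonoidAlgebra.map_add]
  rfl

/-- An involutive anti-automorphism of a monoid extends to a `*`-structure on its algebra. -/
@[reducible] def monoidAlgebraStarRing {M : Type} [Monoid M] (s : M → M)
    (hs : ∀ x, s (s x) = x) (hm : ∀ x y, s (x * y) = s y * s x) :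
    StarRing (MonoidAlgebra ℂ M) where
  star := monoidAlgebraStar s
  star_involutive x := by
    induction x using MonoidAlgebra.induction_linear with
    | zero => simp [monoidAlgebraStar]
    | add x y hx hy => rw [monoidAlgebraStar_add, monoidAlgebraStar_add, hx, hy]
    | single m c => rw [monoidAlgebraStar_single, monoidAlgebraStar_single, hs, star_star]
  star_mul x y := by
    induction x using MonoidAlgebra.induction_linear with
    | zero => simp [monoidAlgebraStar]
    | add x x' hx hx' =>
      rw [add_mul, monoidAlgebraStar_add, hx, hx', monoidAlgebraStar_add, mul_add]
    | single m c =>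
      induction y using MonoidAlgebra.induction_linear with
      | zero => simp [monoidAlgebraStar]
      | add y y' hy hy' =>
        rw [mul_add, monoidAlgebraStar_add, hy, hy', monoidAlgebraStar_add, add_mul]
      | single n d =>
        rw [MonoidAlgebra.single_mul_single, monoidAlgebraStar_single, monoidAlgebraStar_single,
          monoidAlgebraStar_single, MonoidAlgebra.single_mul_single, hm, star_mul]
  star_add := monoidAlgebraStar_add s

/-- The group `*`-algebra `ℂΓ`, with `(∑ c_g g)^* = ∑ \bar c_g g⁻¹`. -/
instance groupAlgebraStarRing {Γ : Type} [Group Γ] : StarRing (MonoidAlgebra ℂ Γ) :=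
  monoidAlgebraStarRing (fun g => g⁻¹) inv_inv mul_inv_rev

instance groupAlgebraStarModule {Γ : Type} [Group Γ] : StarModule ℂ (MonoidAlgebra ℂ Γ) where
  star_smul c x := by
    induction x using MonoidAlgebra.induction_linear with
    | zero => simp
    | add x y hx hy => rw [smul_add, star_add, hx, hy, star_add, smul_add]
    | single m d =>
      rw [MonoidAlgebra.smul_single]
      refine (monoidAlgebraStar_single _ _ _).trans ?_
      refine Eq.trans ?_ (congrArg (star c • ·) (monoidAlgebraStar_single _ _ _).symm)
      rw [MonoidAlgebra.smul_single, smul_eq_mul, smul_eq_mul, star_mul']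

/-! ## The semidirect product `\hat Γ ⋊ H` -/

/-- The fundamental representation `u_{ij} = γ_i v_{ij}` of `\hat Γ ⋊ H`, for a group `Γ` with
generators `g_i` and a permutation group `H`. The underlying `*`-algebra is `ℂΓ ⊗ O(H)`, where
`O(H)` is the algebra of all complex functions on the finite group `H`; `γ_i ∈ ℂΓ` is the generator
`g_i`, and `v_{ij}(σ) = δ_{iσ(j)}`. -/
def semidirectMatrix {V Γ : Type} [DecidableEq V] [Group Γ] (g : V → Γ)
    (H : Subgroup (Equiv.Perm V)) :
    Matrix V V (MonoidAlgebra ℂ Γ ⊗[ℂ] (H → ℂ)) :=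
  Matrix.of fun i j =>
    MonoidAlgebra.of ℂ Γ (g i) ⊗ₜ[ℂ] fun σ : H => if i = (σ : Equiv.Perm V) j then (1 : ℂ) else 0

/-! ## The quantum group associated to a graph category -/

/-- The free `*`-algebra on self-adjoint generators `u_{ij}`, `i, j ∈ V`. -/
abbrev FreeStarAlgebra (V : Type) : Type := MonoidAlgebra ℂ (FreeMonoid (V × V))

namespace FreeStarAlgebra

/-- The involution is conjugate-linear, fixes the generators and reverses words. -/
instance {V : Type} : StarRing (FreeStarAlgebra V) :=
  monoidAlgebraStarRing (fun w => star w) star_star star_mul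

instance {V : Type} : StarModule ℂ (FreeStarAlgebra V) where
  star_smul c x := by
    induction x using MonoidAlgebra.induction_linear with
    | zero => simp
    | add x y hx hy => rw [smul_add, star_add, hx, hy, star_add, smul_add]
    | single m d =>
      rw [MonoidAlgebra.smul_single]
      refine (monoidAlgebraStar_single _ _ _).trans ?_
      refine Eq.trans ?_ (congrArg (star c • ·) (monoidAlgebraStar_single _ _ _).symm)
      rw [MonoidAlgebra.smul_single, smul_eq_mul, smul_eq_mul, star_mul']

/-- The matrix of generators. -/
def gens (V : Type) : Matrix V V (FreeStarAlgebra V) :=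
  Matrix.of fun i j => MonoidAlgebra.of ℂ (FreeMonoid (V × V)) (FreeMonoid.of (i, j))

end FreeStarAlgebra

/-- The relations `T^G_K u^{⊗k} = u^{⊗l} T^G_K`, for all `K ∈ C(k, l)`, and their adjoints. -/
inductive AssociatedRel (G : LoopGraph) (C : GraphCategory) :
    FreeStarAlgebra G.V → FreeStarAlgebra G.V → Prop
  | intertwine {k l : ℕ} (K : BilabelledGraph k l) (hK : K ∈ C.mor k l)
      (j : Fin l → G.V) (i : Fin k → G.V) :
      AssociatedRel G C
        (((homMatrix G K).map (algebraMap ℂ (FreeStarAlgebra G.V)) *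
          tensorPow (FreeStarAlgebra.gens G.V) k) j i)
        ((tensorPow (FreeStarAlgebra.gens G.V) l *
          (homMatrix G K).map (algebraMap ℂ (FreeStarAlgebra G.V))) j i)
  | adjoint {x y : FreeStarAlgebra G.V} (h : AssociatedRel G C x y) :
      AssociatedRel G C (star x) (star y)

/-- The universal `*`-algebra generated by self-adjoint `u_{ij}`, `i, j ∈ V(G)`, subject to the
relations `T^G_K u^{⊗k} = u^{⊗l} T^G_K` for all `K ∈ C(k, l)`. -/
abbrev AssociatedAlgebra (G : LoopGraph) (C : GraphCategory) : Type :=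
  RingQuot (AssociatedRel G C)

instance (G : LoopGraph) (C : GraphCategory) : StarRing (AssociatedAlgebra G C) :=
  RingQuot.starRing (AssociatedRel G C) fun _ _ h => AssociatedRel.adjoint h

/-- The quotient map from the free `*`-algebra preserves the involution. -/
theorem mkAlgHom_star (G : LoopGraph) (C : GraphCategory) (x : FreeStarAlgebra G.V) :
    RingQuot.mkAlgHom ℂ (AssociatedRel G C) (star x) =
      star (RingQuot.mkAlgHom ℂ (AssociatedRel G C) x) := by
  simp only [RingQuot.mkAlgHom_def, RingQuot.mkRingHom_def]
  rfl

instance (G : LoopGraph) (C : GraphCategory) : StarModule ℂ (AssociatedAlgebra G C) where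
  star_smul c x := by
    obtain ⟨y, rfl⟩ := RingQuot.mkAlgHom_surjective ℂ (AssociatedRel G C) x
    rw [← map_smul, ← mkAlgHom_star, ← mkAlgHom_star, star_smul, map_smul]

/-- The fundamental representation of the quantum group associated to `G` and `C`. -/
def associatedMatrix (G : LoopGraph) (C : GraphCategory) :
    Matrix G.V G.V (AssociatedAlgebra G C) :=
  (FreeStarAlgebra.gens G.V).map (RingQuot.mkAlgHom ℂ (AssociatedRel G C))

end

/-! Both sides of the theorem are compared with a third object, the space `admissible F G k l` of
matrices that are invariant under Aut G and supported on pairs of words congruent modulo F(G).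

Homomorphism matrices are admissible because homomorphisms K → G carry F(K) into F(G)
(`map_hom_mem`). Conversely, sorting homomorphisms by kernel and inverting over quotients of K puts
the matrices counting injective homomorphisms into the span. For K = G, injective endomorphisms are
automorphisms, so every admissible matrix is an average of such matrices over Aut G
(`span_homMatrices`). On the other side, ℂΓ ⊗ O(Aut G) is the algebra of functions Aut G → ℂΓ.
Evaluating the intertwiner equation for γ_i v_{ij} at each automorphism leaves exactly the
admissibility conditions (`intertwiners_semidirectMatrix`).

Equality of intertwiner spaces gives a surjection from the universal algebra onto ℂΓ ⊗ O(Aut G). Its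
inverse is built by hand, for any algebra generated by a matrix w satisfying the relations. Entries
within a row multiply to zero, the squares p_{ac} = w_{ac}² are central idempotents, and the row
sums r_a satisfy the relations of Γ, with w_{ac} = r_a p_{ac}. The products of the p_{aσ⁻¹(a)} over
all vertices a, for σ in Aut G, are orthogonal idempotents with sum 1, since the analogous product
for a map that is not an automorphism vanishes (`prod_centralSq_eq_zero`). Hence r and p define a
homomorphism out of ℂΓ ⊗ O(Aut G), namely `semidirectHom`. -/

noncomputable section

/-! ### Homomorphisms and fibres -/

namespace LoopGraph

variable {K G : LoopGraph}

/-- Gluing `K` onto `G` along a homomorphism gives back `G`. -/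
def quotKerIso (φ : K.Hom G) :
    ((K.disjUnion G).quot (Setoid.ker (Sum.elim φ id : (K.disjUnion G).V → G.V))).Iso G where
  toFun p := Quotient.liftOn p (Sum.elim φ id : (K.disjUnion G).V → G.V) fun _ _ h => h
  invFun x := Quotient.mk _ (K.inr G x)
  left_inv := by
    rintro ⟨p⟩
    exact Quotient.sound rfl
  right_inv _ := rfl
  map_rel_iff' := by
    rintro ⟨p⟩ ⟨q⟩
    constructor
    · intro h
      exact ⟨K.inr G _, K.inr G _, Quotient.sound rfl, Quotient.sound rfl, Sum.LiftRel.inr h⟩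
    · rintro ⟨x, y, hx, hy, h⟩
      have hx' : (Sum.elim φ id : (K.disjUnion G).V → G.V) x = Sum.elim φ id p := Quotient.exact hx
      have hy' : (Sum.elim φ id : (K.disjUnion G).V → G.V) y = Sum.elim φ id q := Quotient.exact hy
      change G.Adj (Sum.elim φ id p) (Sum.elim φ id q)
      rw [← hx', ← hy']
      cases h with
      | inl h => exact φ.map_rel h
      | inr h => exact h

/-- An automorphism of `G`, as a graph isomorphism. -/
def autIso (σ : G.autGroup) : G.Iso G where
  toEquiv := σ
  map_rel_iff' := σ.2 _ _

end LoopGraph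

namespace FreeZ2

/-- No inverses are needed, as each factor ℤ₂ has only the identity and its generator. This lets
statements about words reach all of F(G). -/
theorem exists_word {V : Type} (g : FreeZ2 V) : ∃ (k : ℕ) (a : Fin k → V), word a = g := by
  have one : ∃ (k : ℕ) (a : Fin k → V), word a = 1 := ⟨0, Fin.elim0, rfl⟩
  have mul : ∀ g h : FreeZ2 V, (∃ (k : ℕ) (a : Fin k → V), word a = g) →
      (∃ (k : ℕ) (a : Fin k → V), word a = h) → ∃ (k : ℕ) (a : Fin k → V), word a = g * h := by
    rintro _ _ ⟨k, a, rfl⟩ ⟨l, b, rfl⟩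
    exact ⟨k + l, Fin.append a b, word_append a b⟩
  induction g using Monoid.CoprodI.induction_on with
  | one => exact one
  | of v x =>
    have hx : x = 1 ∨ x = Multiplicative.ofAdd 1 := by
      revert x; decide
    obtain rfl | rfl := hx
    · simpa using one
    · exact ⟨1, fun _ => v, by simp [word, gen]⟩
  | mul g h hg hh => exact mul g h hg hh

end FreeZ2

namespace GraphFibration

variable {F : GraphFibration} {K G : LoopGraph}

/-- The fibres of an easy graph fibration are mapped into each other by homomorphisms. -/
theorem map_hom_mem (hF : F.IsEasy) (hG : F.Mem G) (φ : K.Hom G) {a : FreeZ2 K.V}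
    (ha : a ∈ F.fibre K) : FreeZ2.map φ a ∈ F.fibre G := by
  -- Pair a with the trivial element over G; collapsing K ⊔ G along φ and the identity returns G and
  -- sends a to φ(a).
  have h1 : (1 : FreeZ2 G.V) ∈ F.fibre G := (F.fibreSubgroup G hG).one_mem
  have h := F.disjUnion_mem ha h1
  rw [map_one, mul_one] at h
  have h := F.iso_mem (LoopGraph.quotKerIso φ) (hF _ _ _ h)
  have e := (congrArg (FreeZ2.map (LoopGraph.quotKerIso φ)) (FreeZ2.map_map (K.inl G)
    (Quotient.mk (Setoid.ker (Sum.elim φ id : (K.disjUnion G).V → G.V))) a)).trans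
    (FreeZ2.map_map _ (LoopGraph.quotKerIso φ) a)
  exact Set.mem_of_eq_of_mem e.symm h

end GraphFibration

/-! ### The span of the homomorphism matrices -/

/-- The matrices which are invariant under `Aut G` and supported on pairs of words that agree
modulo `F(G)`. -/
def admissible (F : GraphFibration) (G : LoopGraph) (k l : ℕ) :
    Submodule ℂ (Matrix (Fin l → G.V) (Fin k → G.V) ℂ) where
  carrier := {T | (∀ j i, T j i ≠ 0 → (FreeZ2.word i)⁻¹ * FreeZ2.word j ∈ F.fibre G) ∧
    ∀ (σ : G.autGroup) j i, T (⇑(σ : Equiv.Perm G.V) ∘ j) (⇑(σ : Equiv.Perm G.V) ∘ i) = T j i}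
  add_mem' {S T} hS hT := by
    refine ⟨fun j i h => ?_, fun σ j i => ?_⟩
    · by_cases hs : S j i = 0
      · refine hT.1 j i fun ht => h ?_
        simp [hs, ht]
      · exact hS.1 j i hs
    · simp [hS.2 σ, hT.2 σ]
  zero_mem' := ⟨fun _ _ h => (h rfl).elim, fun _ _ _ => rfl⟩
  smul_mem' c T hT :=
    ⟨fun j i h => hT.1 j i fun ht => h (by simp [ht]), fun σ j i => by simp [hT.2 σ]⟩

theorem mem_admissible {F : GraphFibration} {G : LoopGraph} {k l : ℕ}
    {T : Matrix (Fin l → G.V) (Fin k → G.V) ℂ} :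
    T ∈ admissible F G k l ↔
      (∀ j i, T j i ≠ 0 → (FreeZ2.word i)⁻¹ * FreeZ2.word j ∈ F.fibre G) ∧
      ∀ (σ : G.autGroup) j i,
        T (⇑(σ : Equiv.Perm G.V) ∘ j) (⇑(σ : Equiv.Perm G.V) ∘ i) = T j i :=
  Iff.rfl

/-- The homomorphisms `K → G` with prescribed values on the inputs and outputs. -/
abbrev LabelledHom (G : LoopGraph) {k l : ℕ} (K : BilabelledGraph k l) (j : Fin l → G.V)
    (i : Fin k → G.V) : Type :=
  {φ : K.toLoopGraph.Hom G // (∀ m, φ (K.inp m) = i m) ∧ ∀ m, φ (K.out m) = j m}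

instance (K G : LoopGraph) : Finite (K.Hom G) := DFunLike.finite _

instance (V : Type) [Finite V] : Finite (Setoid V) :=
  Finite.of_injective (fun s : Setoid V => fun x y => s x y) fun s t h => by
    ext x y
    exact iff_of_eq (congrFun (congrFun h x) y)

/-- A homomorphism counted by a nonzero entry transports the membership of K to the labels in G;
composing with an automorphism permutes the homomorphisms, whence the invariance. -/
theorem homMatrix_mem_admissible {F : GraphFibration} (hF : F.IsEasy) {G : LoopGraph}
    (hG : F.Mem G) {k l : ℕ} {K : BilabelledGraph k l} (hK : K ∈ (F.category hF).mor k l) :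
    homMatrix G K ∈ admissible F G k l := by
  refine ⟨fun j i h => ?_, fun σ j i => ?_⟩
  · have h' : Nat.card (LabelledHom G K j i) ≠ 0 := fun e => h (by simp [homMatrix, e])
    obtain ⟨⟨φ, hi, hj⟩⟩ := (Nat.card_ne_zero.1 h').1
    have := GraphFibration.map_hom_mem hF hG φ hK
    rw [map_mul, map_inv, FreeZ2.map_word, FreeZ2.map_word] at this
    rwa [show φ ∘ K.inp = i from funext hi, show φ ∘ K.out = j from funext hj] at this
  · let e (σ : G.autGroup) (φ : K.toLoopGraph.Hom G) : K.toLoopGraph.Hom G :=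
      ⟨fun x => (σ : Equiv.Perm G.V) (φ x), fun h => (σ.2 _ _).2 (φ.map_rel h)⟩
    have : Nat.card (LabelledHom G K j i) =
        Nat.card (LabelledHom G K (⇑(σ : Equiv.Perm G.V) ∘ j) (⇑(σ : Equiv.Perm G.V) ∘ i)) :=
      Nat.card_congr
        { toFun := fun φ => ⟨e σ φ.1, fun m => congrArg (σ : Equiv.Perm G.V) (φ.2.1 m),
            fun m => congrArg (σ : Equiv.Perm G.V) (φ.2.2 m)⟩
          invFun := fun φ => ⟨e σ⁻¹ φ.1,
            fun m => (congrArg (σ⁻¹ : Equiv.Perm G.V) (φ.2.1 m)).trans (Equiv.symm_apply_apply _ _),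
            fun m => (congrArg (σ⁻¹ : Equiv.Perm G.V) (φ.2.2 m)).trans
              (Equiv.symm_apply_apply _ _)⟩
          left_inv := fun φ => Subtype.ext <| RelHom.ext fun x => Equiv.symm_apply_apply _ _
          right_inv := fun φ => Subtype.ext <| RelHom.ext fun x => Equiv.apply_symm_apply _ _ }
    simp only [homMatrix, Matrix.of_apply]
    exact congrArg _ this.symm

/-- The matrix counting the homomorphisms `K → G` with kernel `π`. -/
def kerMatrix (G : LoopGraph) {k l : ℕ} (K : BilabelledGraph k l) (π : Setoid K.V) :
    Matrix (Fin l → G.V) (Fin k → G.V) ℂ :=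
  Matrix.of fun j i => (Nat.card {φ : LabelledHom G K j i // Setoid.ker φ.1 = π} : ℂ)

theorem homMatrix_eq_sum (G : LoopGraph) {k l : ℕ} (K : BilabelledGraph k l)
    [Fintype (Setoid K.V)] : homMatrix G K = ∑ π, kerMatrix G K π := by
  ext j i
  rw [Matrix.sum_apply]
  simp only [homMatrix, kerMatrix, Matrix.of_apply]
  rw [← Nat.cast_sum, ← Nat.card_sigma]
  exact congrArg _ (Nat.card_congr (Equiv.sigmaFiberEquiv _).symm)

/-- A homomorphism with kernel π is the same as an injective homomorphism on K/π. -/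
theorem kerMatrix_quot (G : LoopGraph) {k l : ℕ} (K : BilabelledGraph k l) (π : Setoid K.V) :
    kerMatrix G K π = kerMatrix G (K.quot π) ⊥ := by
  ext j i
  simp only [kerMatrix, Matrix.of_apply]
  refine congrArg _ (Nat.card_congr ?_)
  exact
  { toFun := fun φ => ⟨⟨⟨fun p => Quotient.liftOn p φ.1.1 fun x y h => by
            have h' : Setoid.ker φ.1.1 x y := by rw [φ.2]; exact h
            exact h', by
          rintro _ _ ⟨x, y, rfl, rfl, h⟩
          exact φ.1.1.map_rel h⟩, φ.1.2⟩, by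
        rw [Setoid.ker_eq_bot_iff]
        rintro ⟨x⟩ ⟨y⟩ h
        refine Quotient.sound ?_
        change π x y
        rw [← φ.2]
        exact h⟩
    invFun := fun ψ => ⟨⟨⟨fun x => ψ.1.1 (Quotient.mk π x), fun h =>
          ψ.1.1.map_rel ⟨_, _, rfl, rfl, h⟩⟩, ψ.1.2⟩, by
        ext x y
        have h := Setoid.ker_eq_bot_iff.1 ψ.2
        exact ⟨fun e => Quotient.exact (h e), fun e => congrArg ψ.1.1 (Quotient.sound e)⟩⟩
    left_inv := fun φ => rfl
    right_inv := fun ψ => by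
      refine Subtype.ext (Subtype.ext (RelHom.ext ?_))
      rintro ⟨x⟩
      rfl }

/-- Möbius inversion by induction on the number of vertices: subtract from `homMatrix G K` the terms
of nontrivial kernel, which count injective homomorphisms on proper quotients. Closure of C under
quotients is essential here. -/
theorem kerMatrix_bot_mem (G : LoopGraph) (C : GroupTheoreticalGraphCategory) {k l : ℕ} (n : ℕ) :
    ∀ K ∈ C.mor k l, Nat.card K.V = n →
      kerMatrix G K ⊥ ∈ Submodule.span ℂ (homMatrices G C.toGraphCategory k l) := by
  classical
  induction n using Nat.strong_induction_on with
  | _ n ih =>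
    rintro K hK rfl
    have := Fintype.ofFinite (Setoid K.V)
    have h := homMatrix_eq_sum G K
    rw [← Finset.add_sum_erase _ _ (Finset.mem_univ ⊥), ← sub_eq_iff_eq_add] at h
    rw [← h]
    refine Submodule.sub_mem _ (Submodule.subset_span ⟨K, hK, rfl⟩)
      (Submodule.sum_mem _ fun π hπ => ?_)
    rw [kerMatrix_quot]
    refine ih _ ?_ _ (C.quot_mem π hK) rfl
    -- If no vertices were lost, the quotient map would be injective and π trivial.
    refine lt_of_le_of_ne (Nat.card_le_card_of_surjective _ Quotient.mk_surjective) fun e => ?_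
    refine (Finset.mem_erase.1 hπ).1 ?_
    have hb := (Nat.bijective_iff_surjective_and_card (Quotient.mk π)).2
      ⟨Quotient.mk_surjective, e.symm⟩
    rw [← Setoid.ker_mk_eq π, Setoid.ker_eq_bot_iff]
    exact hb.1

/-- The graph `G` with labels. -/
def BilabelledGraph.ofLabels (G : LoopGraph) {k l : ℕ} (j : Fin l → G.V) (i : Fin k → G.V) :
    BilabelledGraph k l where
  toLoopGraph := G
  inp := i
  out := j

/-- An injective endomorphism of a finite graph is an automorphism. -/
theorem LoopGraph.exists_aut_of_injective {G : LoopGraph} (φ : G.Hom G)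
    (hφ : Function.Injective φ) : ∃ σ : G.autGroup, ∀ x, (σ : Equiv.Perm G.V) x = φ x := by
  let e : Equiv.Perm G.V := Equiv.ofBijective φ (Finite.injective_iff_bijective.1 hφ)
  -- The induced injection on the finite set of adjacent pairs is surjective, so φ also reflects
  -- adjacency.
  have hs : Function.Injective (fun p : {p : G.V × G.V // G.Adj p.1 p.2} =>
      (⟨(φ p.1.1, φ p.1.2), φ.map_rel p.2⟩ : {p : G.V × G.V // G.Adj p.1 p.2})) := by
    rintro ⟨⟨a, b⟩, h⟩ ⟨⟨c, d⟩, h'⟩ e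
    simp only [Subtype.mk.injEq, Prod.mk.injEq] at e
    simp [hφ e.1, hφ e.2]
  have hs := Finite.injective_iff_surjective.1 hs
  refine ⟨⟨e, fun x y => ⟨fun h => ?_, fun h => φ.map_rel h⟩⟩, fun x => rfl⟩
  obtain ⟨⟨⟨a, b⟩, hab⟩, e⟩ := hs ⟨(φ x, φ y), h⟩
  have e := congrArg Subtype.val e
  rw [← hφ (congrArg Prod.fst e), ← hφ (congrArg Prod.snd e)]
  exact hab

theorem kerMatrix_ofLabels (G : LoopGraph) {k l : ℕ} (j j' : Fin l → G.V) (i i' : Fin k → G.V) :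
    kerMatrix G (BilabelledGraph.ofLabels G j i) ⊥ j' i' =
      Nat.card {σ : G.autGroup // ⇑(σ : Equiv.Perm G.V) ∘ i = i' ∧
        ⇑(σ : Equiv.Perm G.V) ∘ j = j'} := by
  simp only [kerMatrix, Matrix.of_apply]
  refine congrArg _ (Nat.card_congr (Equiv.symm ?_))
  refine Equiv.ofBijective (fun σ => ⟨⟨⟨(σ.1 : Equiv.Perm G.V), fun h => (σ.1.2 _ _).2 h⟩,
    fun m => congrFun σ.2.1 m, fun m => congrFun σ.2.2 m⟩,
    Setoid.ker_eq_bot_iff.2 (σ.1 : Equiv.Perm G.V).injective⟩) ⟨?_, ?_⟩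
  · rintro ⟨σ, h⟩ ⟨τ, h'⟩ e
    refine Subtype.ext (Subtype.ext (Equiv.ext fun x => ?_))
    exact DFunLike.congr_fun (congrArg (fun φ => φ.1.1) e) x
  · rintro ⟨⟨φ, hi, hj⟩, hφ⟩
    obtain ⟨σ, hσ⟩ := LoopGraph.exists_aut_of_injective φ (Setoid.ker_eq_bot_iff.1 hφ)
    refine ⟨⟨σ, funext fun m => (hσ _).trans (hi m), funext fun m => (hσ _).trans (hj m)⟩, ?_⟩
    exact Subtype.ext (Subtype.ext (RelHom.ext hσ))

/-- For the hard inclusion, T is expanded in the matrices of G itself labelled by (j, i). The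
support condition says that this labelled graph lies in the category whenever T j i ≠ 0; the
invariance makes the sum equal to |Aut G| · T. -/
theorem span_homMatrices {F : GraphFibration} (hF : F.IsEasy) {G : LoopGraph} (hG : F.Mem G)
    (k l : ℕ) :
    Submodule.span ℂ (homMatrices G (F.category hF).toGraphCategory k l) = admissible F G k l := by
  classical
  apply le_antisymm
  · rw [Submodule.span_le]
    rintro _ ⟨K, hK, rfl⟩
    exact homMatrix_mem_admissible hF hG hK
  · intro T hT
    have := Fintype.ofFinite G.autGroup
    have key : ∑ j, ∑ i, T j i • kerMatrix G (BilabelledGraph.ofLabels G j i) ⊥ =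
        (Fintype.card G.autGroup : ℂ) • T := by
      ext j' i'
      simp only [Matrix.sum_apply, Matrix.smul_apply, kerMatrix_ofLabels, smul_eq_mul]
      -- Each σ contributes at the single pair (σ⁻¹j', σ⁻¹i'), where T has the value T j' i'.
      have h (j i) : T j i * (Nat.card {σ : G.autGroup // ⇑(σ : Equiv.Perm G.V) ∘ i = i' ∧
          ⇑(σ : Equiv.Perm G.V) ∘ j = j'} : ℂ) = ∑ σ : G.autGroup,
            if j = ⇑(σ⁻¹ : Equiv.Perm G.V) ∘ j' then
              if i = ⇑(σ⁻¹ : Equiv.Perm G.V) ∘ i' then T j' i' else 0 else 0 := by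
        rw [Nat.card_eq_fintype_card, Fintype.card_subtype, Finset.card_filter, Nat.cast_sum,
          Finset.mul_sum]
        refine Finset.sum_congr rfl fun σ _ => ?_
        have e {n : ℕ} (a b : Fin n → G.V) : a = ⇑(σ⁻¹ : Equiv.Perm G.V) ∘ b ↔
            ⇑(σ : Equiv.Perm G.V) ∘ a = b := by
          constructor
          · rintro rfl
            funext m
            simp
          · rintro rfl
            funext m
            simp
        simp only [e]
        split_ifs with h1 h2 h3 h3
        · rw [← hT.2 σ, h2, h3]; simp
        all_goals simp_all
      simp only [h]
      simp_rw [Finset.sum_comm (s := (Finset.univ : Finset (Fin k → G.V)))]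
      rw [Finset.sum_comm]
      simp
    have hc : (Fintype.card G.autGroup : ℂ) ≠ 0 := by
      simp [Fintype.card_ne_zero]
    rw [← Submodule.smul_mem_iff _ hc, ← key]
    refine Submodule.sum_mem _ fun j _ => Submodule.sum_mem _ fun i _ => ?_
    by_cases h : T j i = 0
    · simp [h]
    · exact Submodule.smul_mem _ _ (kerMatrix_bot_mem G (F.category hF) _ _
        (hT.1 j i h : BilabelledGraph.ofLabels G j i ∈ (F.category hF).mor k l) rfl)

/-! ### Intertwiners of the semidirect product -/

theorem mem_intertwiners_iff {V A : Type} [Fintype V] [DecidableEq V] [Ring A] [Algebra ℂ A]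
    {u : Matrix V V A} {k l : ℕ} {T : Matrix (Fin l → V) (Fin k → V) ℂ} :
    T ∈ intertwiners u k l ↔ ∀ j i,
      ∑ i', T j i' • tensorPow u k i' i = ∑ j', T j' i • tensorPow u l j j' := by
  simp only [intertwiners, Set.mem_ofPred_eq, ← Matrix.ext_iff, Matrix.mul_apply, Matrix.map_apply,
    ← Algebra.commutes, ← Algebra.smul_def]

section Semidirect

variable {V Γ : Type} [DecidableEq V] [Group Γ]

theorem list_prod_map_tmul {A B I : Type} [Ring A] [Algebra ℂ A] [Ring B] [Algebra ℂ B]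
    (a : I → A) (b : I → B) (s : List I) :
    (s.map fun m => a m ⊗ₜ[ℂ] b m).prod = (s.map a).prod ⊗ₜ[ℂ] (s.map b).prod := by
  induction s with
  | nil => rfl
  | cons m s ih => simp [ih]

theorem tensorPow_semidirectMatrix (g : V → Γ) (H : Subgroup (Equiv.Perm V)) {k : ℕ}
    (j i : Fin k → V) :
    tensorPow (semidirectMatrix g H) k j i =
      MonoidAlgebra.of ℂ Γ (List.ofFn fun m => g (j m)).prod ⊗ₜ[ℂ]
        fun σ : H => if j = ⇑(σ : Equiv.Perm V) ∘ i then (1 : ℂ) else 0 := by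
  simp only [tensorPow, semidirectMatrix, Matrix.of_apply, List.ofFn_eq_map]
  rw [list_prod_map_tmul, map_list_prod, List.map_map]
  congr 1
  ext σ
  rw [← List.ofFn_eq_map, List.prod_ofFn, Finset.prod_apply, Finset.prod_ite_zero]
  simp [funext_iff]

/-- Under ℂΓ ⊗ O(H) ≅ (H → ℂΓ), evaluation at σ leaves one summand on each side of the intertwiner
equation. The row index is taken as σ ∘ j to make both sides explicit. -/
theorem mem_intertwiners_semidirectMatrix [Fintype V] (g : V → Γ) (H : Subgroup (Equiv.Perm V))
    {k l : ℕ} (T : Matrix (Fin l → V) (Fin k → V) ℂ) :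
    T ∈ intertwiners (semidirectMatrix g H) k l ↔
      ∀ (σ : H) (j : Fin l → V) (i : Fin k → V),
        MonoidAlgebra.single (List.ofFn fun m => g ((σ : Equiv.Perm V) (i m))).prod
            (T (⇑(σ : Equiv.Perm V) ∘ j) (⇑(σ : Equiv.Perm V) ∘ i)) =
          MonoidAlgebra.single (List.ofFn fun m => g ((σ : Equiv.Perm V) (j m))).prod (T j i) := by
  classical
  have ev (σ : H) (j : Fin l → V) (i : Fin k → V) :
      TensorProduct.piScalarRight ℂ ℂ (MonoidAlgebra ℂ Γ) H
        (∑ i', T j i' • tensorPow (semidirectMatrix g H) k i' i) σ =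
      MonoidAlgebra.single (List.ofFn fun m => g ((σ : Equiv.Perm V) (i m))).prod
            (T j (⇑(σ : Equiv.Perm V) ∘ i)) := by
    simp only [tensorPow_semidirectMatrix,
      map_sum, map_smul, TensorProduct.piScalarRight_apply, TensorProduct.piScalarRightHom_tmul,
      Finset.sum_apply, Pi.smul_apply, MonoidAlgebra.of_apply]
    rw [Finset.sum_eq_single (⇑(σ : Equiv.Perm V) ∘ i)]
    · simp
    · intro b _ hb
      simp [hb]
    · simp
  have ev' (σ : H) (j : Fin l → V) (i : Fin k → V) :
      TensorProduct.piScalarRight ℂ ℂ (MonoidAlgebra ℂ Γ) H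
        (∑ j', T j' i • tensorPow (semidirectMatrix g H) l (⇑(σ : Equiv.Perm V) ∘ j) j') σ =
      MonoidAlgebra.single (List.ofFn fun m => g ((σ : Equiv.Perm V) (j m))).prod (T j i) := by
    simp only [tensorPow_semidirectMatrix,
      map_sum, map_smul, TensorProduct.piScalarRight_apply, TensorProduct.piScalarRightHom_tmul,
      Finset.sum_apply, Pi.smul_apply, MonoidAlgebra.of_apply]
    rw [Finset.sum_eq_single j]
    · simp
    · intro b _ hb
      have : ¬ (⇑(σ : Equiv.Perm V) ∘ j = ⇑(σ : Equiv.Perm V) ∘ b) := fun h =>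
        hb ((σ : Equiv.Perm V).injective.comp_left h).symm
      simp [this]
    · simp
  rw [mem_intertwiners_iff]
  constructor
  · intro h σ j i
    rw [← ev, ← ev', h]
  · intro h j i
    refine (TensorProduct.piScalarRight ℂ ℂ (MonoidAlgebra ℂ Γ) H).injective (funext fun σ => ?_)
    have e := h σ (⇑(σ⁻¹ : Equiv.Perm V) ∘ j) i
    have ej : ⇑(σ : Equiv.Perm V) ∘ (⇑(σ⁻¹ : Equiv.Perm V) ∘ j) = j := by
      funext m
      simp
    rw [← ev, ← ev', ej] at e
    exact e

end Semidirect

theorem prod_ofFn_mk_gen {V : Type} (N : Subgroup (FreeZ2 V)) [N.Normal] {k : ℕ} (i : Fin k → V) :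
    (List.ofFn fun m => (FreeZ2.gen (i m) : FreeZ2 V ⧸ N)).prod = (FreeZ2.word i : FreeZ2 V) := by
  rw [FreeZ2.word, ← QuotientGroup.mk'_apply, map_list_prod, List.map_ofFn]
  rfl

namespace GraphFibration

variable {F : GraphFibration} {G : LoopGraph}

theorem word_comp_mem (σ : G.autGroup) {k l : ℕ} {j : Fin l → G.V} {i : Fin k → G.V}
    (h : (FreeZ2.word i)⁻¹ * FreeZ2.word j ∈ F.fibre G) :
    (FreeZ2.word (⇑(σ : Equiv.Perm G.V) ∘ i))⁻¹ * FreeZ2.word (⇑(σ : Equiv.Perm G.V) ∘ j) ∈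
      F.fibre G := by
  have h := F.iso_mem (LoopGraph.autIso σ) h
  rw [map_mul, map_inv, FreeZ2.map_word, FreeZ2.map_word] at h
  exact h

theorem word_comp_mem_iff (σ : G.autGroup) {k l : ℕ} {j : Fin l → G.V} {i : Fin k → G.V} :
    (FreeZ2.word (⇑(σ : Equiv.Perm G.V) ∘ i))⁻¹ * FreeZ2.word (⇑(σ : Equiv.Perm G.V) ∘ j) ∈
      F.fibre G ↔ (FreeZ2.word i)⁻¹ * FreeZ2.word j ∈ F.fibre G := by
  refine ⟨fun h => ?_, word_comp_mem σ⟩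
  have h := word_comp_mem σ⁻¹ h
  have e {n : ℕ} (a : Fin n → G.V) :
      ⇑((σ⁻¹ : G.autGroup) : Equiv.Perm G.V) ∘ (⇑(σ : Equiv.Perm G.V) ∘ a) = a := by
    funext m
    simp
  rwa [e, e] at h

/-- Two multiples of group elements agree when both group element and coefficient agree, or both
coefficients vanish. The case σ = 1 gives the support condition; comparing coefficients gives
invariance. -/
theorem intertwiners_semidirectMatrix (hG : F.Mem G) (k l : ℕ) :
    intertwiners (semidirectMatrix
      (fun v => (FreeZ2.gen v : FreeZ2 G.V ⧸ F.fibreSubgroup G hG)) G.autGroup) k l =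
    (admissible F G k l : Set _) := by
  ext T
  rw [mem_intertwiners_semidirectMatrix, SetLike.mem_coe, mem_admissible]
  have hw (σ : G.autGroup) {n : ℕ} (i : Fin n → G.V) := prod_ofFn_mk_gen
    (F.fibreSubgroup G hG) (⇑(σ : Equiv.Perm G.V) ∘ i)
  simp only [Function.comp_apply] at hw
  simp only [hw]
  have hq {n m : ℕ} (j : Fin n → G.V) (i : Fin m → G.V) :
      ((FreeZ2.word i : FreeZ2 G.V) : FreeZ2 G.V ⧸ F.fibreSubgroup G hG) = FreeZ2.word j ↔
        (FreeZ2.word i)⁻¹ * FreeZ2.word j ∈ F.fibre G := QuotientGroup.eq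
  simp only [MonoidAlgebra.single_inj, hq, word_comp_mem_iff]
  constructor
  · intro h
    refine ⟨fun j i hT => ?_, fun σ j i => ?_⟩
    · obtain h | h := h 1 j i
      · exact h.1
      · exact (hT h.2).elim
    · obtain h | h := h σ j i
      · exact h.2
      · rw [h.1, h.2]
  · intro h σ j i
    by_cases hT : T j i = 0
    · right
      rw [h.2, hT]
      simp
    · left
      exact ⟨h.1 j i hT, h.2 σ j i⟩

end GraphFibration

/-! ### Relations forced by the admissible matrices -/

namespace FreeZ2

/-- The universal property of `ℤ₂^{*V}`. -/
def lift {V M : Type} [Monoid M] (γ : V → M) (hγ : ∀ v, γ v * γ v = 1) : FreeZ2 V →* M :=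
  Monoid.CoprodI.lift fun v =>
    { toFun := fun x => γ v ^ x.toAdd.val
      map_one' := by simp
      map_mul' := fun x y => by
        have h (x : Multiplicative (ZMod 2)) : x = 1 ∨ x = Multiplicative.ofAdd 1 := by
          revert x; decide
        have h1 : (1 + 1 : ZMod 2) = 0 := by decide
        obtain rfl | rfl := h x <;> obtain rfl | rfl := h y <;>
          simp [hγ, h1, ZMod.val_one] }

theorem lift_gen {V M : Type} [Monoid M] (γ : V → M) (hγ : ∀ v, γ v * γ v = 1) (v : V) :
    lift γ hγ (gen v) = γ v := by
  simp [lift, gen, ZMod.val_one]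

theorem lift_word {V M : Type} [Monoid M] (γ : V → M) (hγ : ∀ v, γ v * γ v = 1) {k : ℕ}
    (a : Fin k → V) : lift γ hγ (word a) = (List.ofFn fun m => γ (a m)).prod := by
  rw [word, map_list_prod, List.map_ofFn]
  simp [Function.comp_def, lift_gen]

end FreeZ2

section TensorPow

variable {V B : Type} [Ring B] (w : Matrix V V B)

theorem tensorPow_zero (j i : Fin 0 → V) : tensorPow w 0 j i = 1 := by
  simp [tensorPow]

theorem tensorPow_succ {k : ℕ} (j i : Fin (k + 1) → V) :
    tensorPow w (k + 1) j i = w (j 0) (i 0) * tensorPow w k (Fin.tail j) (Fin.tail i) := by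
  simp [tensorPow, List.ofFn_succ, Fin.tail_def]

theorem tensorPow_two (j i : Fin 2 → V) :
    tensorPow w 2 j i = w (j 0) (i 0) * w (j 1) (i 1) := by
  simp [tensorPow]

theorem tensorPow_three (j i : Fin 3 → V) :
    tensorPow w 3 j i = w (j 0) (i 0) * (w (j 1) (i 1) * w (j 2) (i 2)) := by
  simp [tensorPow, List.ofFn_succ]

theorem sum_tensorPow [Fintype V] {k : ℕ} (j : Fin k → V) :
    ∑ i, tensorPow w k j i = (List.ofFn fun m => ∑ c, w (j m) c).prod := by
  induction k with
  | zero => simp [tensorPow]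
  | succ k ih =>
    rw [List.ofFn_succ, List.prod_cons]
    change _ = (∑ c, w (j 0) c) * (List.ofFn fun m => ∑ c, w (Fin.tail j m) c).prod
    rw [← ih (Fin.tail j), Finset.sum_mul_sum,
      ← Fintype.sum_prod_type', ← (Fin.consEquiv fun _ => V).sum_comp]
    refine Finset.sum_congr rfl fun x _ => ?_
    simp [tensorPow_succ, Fin.consEquiv]

end TensorPow

/-- Every admissible matrix intertwines tensor powers of `w`. -/
def IntertwinesAdmissible (F : GraphFibration) (G : LoopGraph) {B : Type} [Ring B] [Algebra ℂ B]
    (w : Matrix G.V G.V B) : Prop :=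
  ∀ k l, (admissible F G k l : Set _) ⊆ intertwiners w k l

namespace IntertwinesAdmissible

variable {F : GraphFibration} {G : LoopGraph} {B : Type} [Ring B] [Algebra ℂ B]
  {w : Matrix G.V G.V B}

/-- The diagonal projection onto an Aut G-invariant set of words is admissible, so the tensor power
commutes with it and is block diagonal. -/
theorem tensorPow_eq_zero (hG : F.Mem G) (hw : IntertwinesAdmissible F G w) {k : ℕ}
    {S : (Fin k → G.V) → Prop}
    (hS : ∀ (σ : G.autGroup) i, S (⇑(σ : Equiv.Perm G.V) ∘ i) ↔ S i) {j i : Fin k → G.V}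
    (hj : S j) (hi : ¬ S i) : tensorPow w k j i = 0 := by
  classical
  have hT : (Matrix.of fun j i => if j = i ∧ S i then (1 : ℂ) else 0) ∈ admissible F G k k := by
    rw [mem_admissible]
    refine ⟨fun j i h => ?_, fun σ j i => ?_⟩
    · have h : j = i := by
        by_contra e
        exact h (by simp [e])
      rw [h, inv_mul_cancel]
      exact (F.fibreSubgroup G hG).one_mem
    · simp only [Matrix.of_apply, hS, (σ : Equiv.Perm G.V).injective.comp_left.eq_iff]
  have h := mem_intertwiners_iff.1 (hw k k hT) j i
  rw [Finset.sum_eq_single j (by intro b _ hb; simp [hb.symm]) (by simp)] at h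
  simpa [hj, hi] using h

/-- The indicator vector of words in F(G) is admissible, hence fixed by the tensor power. The
omitted terms of the sum vanish by `tensorPow_eq_zero`. These are the relations of Γ for the row
sums. -/
theorem sum_tensorPow_eq_one (hG : F.Mem G) (hw : IntertwinesAdmissible F G w) {k : ℕ}
    {j : Fin k → G.V} (hj : FreeZ2.word j ∈ F.fibre G) : ∑ i, tensorPow w k j i = 1 := by
  classical
  have h1 : FreeZ2.word (Fin.elim0 : Fin 0 → G.V) = 1 := rfl
  have hS (σ : G.autGroup) (i : Fin k → G.V) :
      FreeZ2.word (⇑(σ : Equiv.Perm G.V) ∘ i) ∈ F.fibre G ↔ FreeZ2.word i ∈ F.fibre G := by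
    have h := GraphFibration.word_comp_mem_iff (F := F) σ (i := Fin.elim0) (j := i)
    rw [Subsingleton.elim (⇑(σ : Equiv.Perm G.V) ∘ Fin.elim0) Fin.elim0, h1] at h
    simpa only [inv_one, one_mul] using h
  have hT : (Matrix.of fun j _ => if FreeZ2.word j ∈ F.fibre G then (1 : ℂ) else 0) ∈
      admissible F G 0 k := by
    rw [mem_admissible]
    refine ⟨fun j i h => ?_, fun σ j i => ?_⟩
    · rw [Subsingleton.elim i Fin.elim0, h1, inv_one, one_mul]
      by_contra e
      exact h (by simp [e])
    · simp only [Matrix.of_apply, hS]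
  have h := mem_intertwiners_iff.1 (hw 0 k hT) j Fin.elim0
  simp only [Matrix.of_apply, hj, if_true, tensorPow_zero, one_smul] at h
  rw [Fintype.sum_unique] at h
  rw [h]
  refine Finset.sum_congr rfl fun i _ => ?_
  split_ifs with hi
  · rw [one_smul]
  · rw [zero_smul, tensorPow_eq_zero (S := fun i => FreeZ2.word i ∈ F.fibre G) hG hw hS hj hi]

theorem mul_eq_zero_of_ne (hG : F.Mem G) (hw : IntertwinesAdmissible F G w) (a : G.V) {c d : G.V}
    (h : c ≠ d) : w a c * w a d = 0 := by
  have := tensorPow_eq_zero hG hw (k := 2) (S := fun i => i 0 = i 1) (j := ![a, a]) (i := ![c, d])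
    (fun σ i => (σ : Equiv.Perm G.V).injective.eq_iff) rfl h
  simpa [tensorPow_two] using this

/-- The map e_c ⊗ e_c ⊗ e_d ↦ e_d ⊗ e_c ⊗ e_c, zero on the other basis vectors, is admissible
because ccd and dcc both represent g_d. -/
theorem sq_commute (hG : F.Mem G) (hw : IntertwinesAdmissible F G w) (a c b d : G.V) :
    w a c * w a c * w b d = w b d * (w a c * w a c) := by
  classical
  have hT : (Matrix.of fun j i : Fin 3 → G.V =>
      if (i 0 = i 1 ∧ j 1 = j 2) ∧ j 0 = i 2 ∧ j 1 = i 0 then (1 : ℂ) else 0) ∈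
      admissible F G 3 3 := by
    rw [mem_admissible]
    refine ⟨fun j i h => ?_, fun σ j i => ?_⟩
    · have h : (i 0 = i 1 ∧ j 1 = j 2) ∧ j 0 = i 2 ∧ j 1 = i 0 := by
        by_contra e
        exact h (by simp only [Matrix.of_apply, e, if_false])
      have e : FreeZ2.word i = FreeZ2.word j := by
        simp only [FreeZ2.word, List.ofFn_succ, List.ofFn_zero, List.prod_cons, List.prod_nil,
          mul_one]
        change FreeZ2.gen (i 0) * (FreeZ2.gen (i 1) * FreeZ2.gen (i 2)) =
          FreeZ2.gen (j 0) * (FreeZ2.gen (j 1) * FreeZ2.gen (j 2))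
        rw [← h.1.1, ← h.1.2, FreeZ2.gen_mul_self, ← mul_assoc, FreeZ2.gen_mul_self, one_mul,
          mul_one, h.2.1]
      rw [e, inv_mul_cancel]
      exact (F.fibreSubgroup G hG).one_mem
    · simp only [Matrix.of_apply, Function.comp_apply, (σ : Equiv.Perm G.V).injective.eq_iff]
  have h := mem_intertwiners_iff.1 (hw 3 3 hT) ![b, a, a] ![c, c, d]
  rw [Finset.sum_eq_single ![a, a, b], Finset.sum_eq_single ![d, c, c]] at h
  · simpa [tensorPow_three, mul_assoc] using h
  · intro j _ hj
    rw [Matrix.of_apply, if_neg, zero_smul]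
    rintro ⟨⟨-, h1⟩, h2, h3⟩
    refine hj (funext fun m => ?_)
    fin_cases m
    · exact h2
    · exact h3
    · exact h1.symm.trans h3
  · simp
  · intro i _ hi
    rw [Matrix.of_apply, if_neg, zero_smul]
    rintro ⟨⟨h1, -⟩, h2, h3⟩
    refine hi (funext fun m => ?_)
    fin_cases m
    · exact h3.symm
    · exact h1.symm.trans h3.symm
    · exact h2.symm
  · simp

end IntertwinesAdmissible

/-! ### The inverse homomorphism, from row sums and central squares -/

/-- The row sums of a matrix. -/
def rowSum {V B : Type} [Fintype V] [Ring B] (w : Matrix V V B) (a : V) : B := ∑ c, w a c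

namespace IntertwinesAdmissible

variable {F : GraphFibration} {G : LoopGraph} {B : Type} [Ring B] [Algebra ℂ B]
  {w : Matrix G.V G.V B}

theorem rowSum_mul_self (hG : F.Mem G) (hw : IntertwinesAdmissible F G w) (a : G.V) :
    rowSum w a * rowSum w a = 1 := by
  have h : FreeZ2.word ![a, a] = 1 := by
    simp [FreeZ2.word, FreeZ2.gen_mul_self]
  have := sum_tensorPow_eq_one hG hw (j := ![a, a]) (by
    rw [h]; exact (F.fibreSubgroup G hG).one_mem)
  rw [sum_tensorPow] at this
  simpa [rowSum] using this

theorem mul_rowSum (hG : F.Mem G) (hw : IntertwinesAdmissible F G w) (a c : G.V) :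
    w a c * rowSum w a = w a c * w a c := by
  rw [rowSum, Finset.mul_sum, Finset.sum_eq_single c]
  · exact fun d _ hd => mul_eq_zero_of_ne hG hw a hd.symm
  · simp

theorem rowSum_mul (hG : F.Mem G) (hw : IntertwinesAdmissible F G w) (a c : G.V) :
    rowSum w a * w a c = w a c * w a c := by
  rw [rowSum, Finset.sum_mul, Finset.sum_eq_single c]
  · exact fun d _ hd => mul_eq_zero_of_ne hG hw a hd
  · simp

/-- This recovers the factorisation γ_a v_{ac} of an entry, with the row sum as γ_a and the square
as v_{ac}. -/
theorem rowSum_mul_sq (hG : F.Mem G) (hw : IntertwinesAdmissible F G w) (a c : G.V) :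
    rowSum w a * (w a c * w a c) = w a c := by
  rw [← rowSum_mul hG hw, ← mul_assoc, rowSum_mul_self hG hw, one_mul]

/-- The homomorphism `ℤ₂^{*V(G)}/F(G) → B` given by the row sums. -/
def groupHom (hG : F.Mem G) (hw : IntertwinesAdmissible F G w) :
    FreeZ2 G.V ⧸ F.fibreSubgroup G hG →* B :=
  QuotientGroup.lift _ (FreeZ2.lift (rowSum w) (rowSum_mul_self hG hw)) fun x hx => by
    -- On a word j the lift is a product of row sums, which expands to the row sum of the tensor
    -- power at j.
    obtain ⟨k, j, rfl⟩ := FreeZ2.exists_word x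
    rw [MonoidHom.mem_ker, FreeZ2.lift_word]
    exact (sum_tensorPow w j).symm.trans (sum_tensorPow_eq_one hG hw hx)

theorem groupHom_gen (hG : F.Mem G) (hw : IntertwinesAdmissible F G w) (a : G.V) :
    groupHom hG hw (FreeZ2.gen a : FreeZ2 G.V) = rowSum w a :=
  FreeZ2.lift_gen _ (rowSum_mul_self hG hw) a

/-- The squares `w_{ac}²` as elements of the centre. -/
def centralSq (hG : F.Mem G) (hw : IntertwinesAdmissible F G w)
    (hB : Algebra.adjoin ℂ (Set.range fun p : G.V × G.V => w p.1 p.2) = ⊤) (a c : G.V) :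
    Subalgebra.center ℂ B :=
  ⟨w a c * w a c, by
    rw [Subalgebra.mem_center_iff]
    intro b
    have hb : b ∈ Algebra.adjoin ℂ (Set.range fun p : G.V × G.V => w p.1 p.2) := by
      rw [hB]; trivial
    induction hb using Algebra.adjoin_induction with
    | mem x hx =>
      obtain ⟨⟨b, d⟩, rfl⟩ := hx
      exact (sq_commute hG hw a c b d).symm
    | algebraMap r => exact Algebra.commutes r _
    | add x y _ _ hx hy => rw [add_mul, mul_add, hx, hy]
    | mul x y _ _ hx hy => rw [mul_assoc, hy, ← mul_assoc, hx, mul_assoc]⟩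

section Central

variable (hG : F.Mem G) (hw : IntertwinesAdmissible F G w)
  (hB : Algebra.adjoin ℂ (Set.range fun p : G.V × G.V => w p.1 p.2) = ⊤)

theorem centralSq_mul_self (a c : G.V) :
    centralSq hG hw hB a c * centralSq hG hw hB a c = centralSq hG hw hB a c := by
  refine Subtype.ext ?_
  change w a c * w a c * (w a c * w a c) = w a c * w a c
  nth_rewrite 1 [← mul_rowSum hG hw]
  rw [mul_assoc, rowSum_mul_sq hG hw]

theorem centralSq_mul_of_ne (a : G.V) {c d : G.V} (h : c ≠ d) :
    centralSq hG hw hB a c * centralSq hG hw hB a d = 0 := by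
  refine Subtype.ext ?_
  change w a c * w a c * (w a d * w a d) = 0
  rw [mul_assoc, ← mul_assoc (w a c) (w a d), mul_eq_zero_of_ne hG hw a h, zero_mul, mul_zero]

theorem sum_centralSq (a : G.V) : ∑ c, centralSq hG hw hB a c = 1 := by
  refine Subtype.ext ?_
  rw [AddSubmonoidClass.coe_finsetSum]
  change ∑ c, w a c * w a c = 1
  rw [← rowSum_mul_self hG hw a]
  conv_rhs => enter [1]; rw [rowSum]
  rw [Finset.sum_mul]
  exact Finset.sum_congr rfl fun c _ => (mul_rowSum hG hw a c).symm

/-- The tensor power, with central squares split off. -/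
theorem tensorPow_eq_prod {k : ℕ} (j i : Fin k → G.V) :
    tensorPow w k j i = (List.ofFn fun m => rowSum w (j m)).prod *
      (∏ m, centralSq hG hw hB (j m) (i m) : Subalgebra.center ℂ B) := by
  induction k with
  | zero => simp [tensorPow_zero]
  | succ k ih =>
    rw [tensorPow_succ, ih, List.ofFn_succ, List.prod_cons, Fin.prod_univ_succ]
    conv_lhs => rw [← rowSum_mul_sq hG hw]
    change _ * (centralSq hG hw hB (j 0) (i 0) : B) * _ = _
    have h (x : B) (p : Subalgebra.center ℂ B) : (p : B) * x = x * p :=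
      (Subalgebra.mem_center_iff.1 p.2 x).symm
    rw [mul_assoc, ← mul_assoc (centralSq hG hw hB (j 0) (i 0) : B), h, mul_assoc, mul_assoc]
    rfl

/-- The projection associated to an automorphism. -/
def centralProj (σ : G.autGroup) : Subalgebra.center ℂ B :=
  ∏ a, centralSq hG hw hB a ((σ⁻¹ : Equiv.Perm G.V) a)

/-- Enumerate all vertices as one word e and take the invariant set of its Aut G-translates. Since f
∘ e lies outside, the tensor power entry at (e, f ∘ e) is zero; it is this product times a product
of row sums, which is a unit. -/
theorem prod_centralSq_eq_zero {f : G.V → G.V}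
    (hf : ∀ σ : G.autGroup, f ≠ ⇑(σ : Equiv.Perm G.V)) :
    ∏ a, centralSq hG hw hB a (f a) = 0 := by
  let e : Fin (Fintype.card G.V) ≃ G.V := (Fintype.equivFin G.V).symm
  have h := tensorPow_eq_zero hG hw (S := fun i => ∃ σ : G.autGroup, i = ⇑(σ : Equiv.Perm G.V) ∘ e)
    (j := e) (i := f ∘ e) (fun σ i => ?_) ⟨1, rfl⟩ ?_
  · rw [tensorPow_eq_prod hG hw hB] at h
    have hu : IsUnit (List.ofFn fun m => rowSum w (e m)).prod := by
      refine List.prod_isUnit fun x hx => ?_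
      obtain ⟨m, rfl⟩ := List.mem_ofFn.1 hx
      exact ⟨⟨_, _, rowSum_mul_self hG hw _, rowSum_mul_self hG hw _⟩, rfl⟩
    rw [hu.mul_right_eq_zero] at h
    rw [← e.prod_comp]
    exact Subtype.ext h
  · constructor
    · rintro ⟨τ, h⟩
      refine ⟨σ⁻¹ * τ, funext fun m => ?_⟩
      have := congrFun h m
      simp only [Function.comp_apply] at this
      simp [← this]
    · rintro ⟨τ, rfl⟩
      exact ⟨σ * τ, rfl⟩
  · rintro ⟨σ, h⟩
    exact hf σ (e.surjective.injective_comp_right h)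

theorem centralProj_mul_self (σ : G.autGroup) :
    centralProj hG hw hB σ * centralProj hG hw hB σ = centralProj hG hw hB σ := by
  rw [centralProj, ← Finset.prod_mul_distrib]
  simp only [centralSq_mul_self]

theorem centralSq_mul_centralProj (a c : G.V) (σ : G.autGroup) :
    centralSq hG hw hB a c * centralProj hG hw hB σ =
      if a = (σ : Equiv.Perm G.V) c then centralProj hG hw hB σ else 0 := by
  rw [centralProj, ← Finset.mul_prod_erase _ _ (Finset.mem_univ a), ← mul_assoc]
  split_ifs with h
  · rw [show (σ⁻¹ : Equiv.Perm G.V) a = c by rw [h]; exact Equiv.symm_apply_apply _ _,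
      centralSq_mul_self]
  · rw [centralSq_mul_of_ne, zero_mul]
    rintro rfl
    simp at h

theorem centralProj_mul_of_ne {σ τ : G.autGroup} (h : σ ≠ τ) :
    centralProj hG hw hB σ * centralProj hG hw hB τ = 0 := by
  obtain ⟨c, hc⟩ : ∃ c, (σ : Equiv.Perm G.V) c ≠ (τ : Equiv.Perm G.V) c := by
    by_contra! e
    exact h (Subtype.ext (Equiv.ext e))
  have h1 := centralSq_mul_centralProj hG hw hB ((σ : Equiv.Perm G.V) c) c σ
  have h2 := centralSq_mul_centralProj hG hw hB ((σ : Equiv.Perm G.V) c) c τ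
  rw [if_pos rfl] at h1
  rw [if_neg hc] at h2
  rw [← h1, mul_right_comm, h2, zero_mul]

/-- Expand ∏_a ∑_c p_{ac} = 1 over all functions a ↦ c; only automorphisms survive. The function
attached to σ is σ⁻¹. -/
theorem sum_centralProj [Fintype G.autGroup] : ∑ σ, centralProj hG hw hB σ = 1 := by
  classical
  have h : ∏ a, ∑ c, centralSq hG hw hB a c = 1 := by
    simp only [sum_centralSq, Finset.prod_const_one]
  rw [Finset.prod_univ_sum, Fintype.piFinset_univ] at h
  rw [← h]
  refine Finset.sum_of_injOn (fun σ => ⇑(σ⁻¹ : Equiv.Perm G.V)) ?_ (by simp) ?_ fun σ _ => rfl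
  · intro σ _ τ _ e
    exact Subtype.ext (inv_injective (Equiv.coe_fn_injective e))
  · intro f _ hf
    refine prod_centralSq_eq_zero hG hw hB fun σ e => hf ⟨σ⁻¹, by simp, ?_⟩
    simp [e]

/-- The algebra homomorphism `O(Aut G) → Z(B)`. -/
def funHom [Fintype G.autGroup] : (G.autGroup → ℂ) →ₐ[ℂ] Subalgebra.center ℂ B :=
  AlgHom.ofLinearMap (∑ σ, (LinearMap.proj σ).smulRight (centralProj hG hw hB σ))
    (by simp [sum_centralProj])
    (fun f g => by
      simp only [LinearMap.coe_sum, Finset.sum_apply, LinearMap.smulRight_apply,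
        LinearMap.proj_apply, Pi.mul_apply, Finset.sum_mul_sum]
      refine Finset.sum_congr rfl fun σ _ => ?_
      rw [Finset.sum_eq_single σ]
      · rw [smul_mul_smul_comm, centralProj_mul_self]
      · intro τ _ hτ
        rw [smul_mul_smul_comm, centralProj_mul_of_ne hG hw hB hτ.symm, smul_zero]
      · simp)

theorem funHom_apply [Fintype G.autGroup] (f : G.autGroup → ℂ) :
    funHom hG hw hB f = ∑ σ, f σ • centralProj hG hw hB σ := by
  simp [funHom]

theorem funHom_entry [Fintype G.autGroup] (a c : G.V) :
    funHom hG hw hB (fun σ => if a = (σ : Equiv.Perm G.V) c then 1 else 0) =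
      centralSq hG hw hB a c := by
  rw [funHom_apply, ← mul_one (centralSq hG hw hB a c), ← sum_centralProj hG hw hB,
    Finset.mul_sum]
  refine Finset.sum_congr rfl fun σ _ => ?_
  rw [centralSq_mul_centralProj]
  split_ifs <;> simp

/-- The algebra homomorphism `ℂΓ ⊗ O(Aut G) → B`. -/
def semidirectHom [Fintype G.autGroup] :
    MonoidAlgebra ℂ (FreeZ2 G.V ⧸ F.fibreSubgroup G hG) ⊗[ℂ] (G.autGroup → ℂ) →ₐ[ℂ] B :=
  Algebra.TensorProduct.lift (MonoidAlgebra.lift ℂ B _ (groupHom hG hw))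
    ((Subalgebra.center ℂ B).val.comp (funHom hG hw hB))
    fun _ f => Subalgebra.mem_center_iff.1 (funHom hG hw hB f).2 _

theorem semidirectHom_semidirectMatrix [Fintype G.autGroup] (a c : G.V) :
    semidirectHom hG hw hB (semidirectMatrix
      (fun v => (FreeZ2.gen v : FreeZ2 G.V ⧸ F.fibreSubgroup G hG)) G.autGroup a c) = w a c := by
  refine (Algebra.TensorProduct.lift_tmul _ _ _ _ _).trans ?_
  rw [MonoidAlgebra.lift_of, groupHom_gen, AlgHom.comp_apply, funHom_entry]
  exact rowSum_mul_sq hG hw a c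

end Central

end IntertwinesAdmissible

/-! ### Algebras with a matrix of generators -/

theorem tensorPow_map {V A B : Type} [Ring A] [Ring B] (f : A →+* B) (u : Matrix V V A) {k : ℕ}
    (j i : Fin k → V) : tensorPow (u.map f) k j i = f (tensorPow u k j i) := by
  simp [tensorPow, map_list_prod, List.map_ofFn, Function.comp_def]

/-- The intertwiners as a submodule. -/
def intertwinerSubmodule {V A : Type} [Fintype V] [DecidableEq V] [Ring A] [Algebra ℂ A]
    (u : Matrix V V A) (k l : ℕ) : Submodule ℂ (Matrix (Fin l → V) (Fin k → V) ℂ) where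
  carrier := intertwiners u k l
  add_mem' {S T} hS hT := by
    rw [mem_intertwiners_iff] at *
    intro j i
    simp only [Matrix.add_apply, add_smul, Finset.sum_add_distrib, hS j i, hT j i]
  zero_mem' := by simp [mem_intertwiners_iff]
  smul_mem' c T hT := by
    rw [mem_intertwiners_iff] at *
    intro j i
    simp only [Matrix.smul_apply, smul_assoc, ← Finset.smul_sum, hT j i]

section Comul

variable {V A : Type} [Fintype V] [Ring A] [Algebra ℂ A] (u : Matrix V V A)

/-- The matrix with entries `∑ k, u_{ik} ⊗ u_{kj}`. -/
def comulMatrix : Matrix V V (A ⊗[ℂ] A) := Matrix.of fun i j => ∑ k, u i k ⊗ₜ[ℂ] u k j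

theorem tensorPow_comulMatrix {k : ℕ} (j i : Fin k → V) :
    tensorPow (comulMatrix u) k j i = ∑ m, tensorPow u k j m ⊗ₜ[ℂ] tensorPow u k m i := by
  induction k with
  | zero => simp [tensorPow_zero, Algebra.TensorProduct.one_def]
  | succ k ih =>
    rw [tensorPow_succ, ih, comulMatrix, Matrix.of_apply, Finset.sum_mul_sum,
      ← Fintype.sum_prod_type', ← (Fin.consEquiv fun _ => V).sum_comp]
    refine Finset.sum_congr rfl fun x _ => ?_
    rw [Algebra.TensorProduct.tmul_mul_tmul]
    simp [tensorPow_succ, Fin.consEquiv]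

/-- T is moved past the first tensor leg, then past the second. Thus the comultiplication will
respect the defining relations. -/
theorem intertwiners_subset_comulMatrix [DecidableEq V] (k l : ℕ) :
    intertwiners u k l ⊆ intertwiners (comulMatrix u) k l := by
  intro T hT
  rw [mem_intertwiners_iff] at *
  intro j i
  simp only [tensorPow_comulMatrix, Finset.smul_sum]
  calc ∑ x, ∑ m, T j x • (tensorPow u k x m ⊗ₜ[ℂ] tensorPow u k m i)
      = ∑ m, (∑ x, T j x • tensorPow u k x m) ⊗ₜ[ℂ] tensorPow u k m i := by
        rw [Finset.sum_comm]
        simp only [TensorProduct.sum_tmul, TensorProduct.smul_tmul']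
    _ = ∑ m, ∑ y, tensorPow u l j y ⊗ₜ[ℂ] (T y m • tensorPow u k m i) := by
        simp only [hT, TensorProduct.sum_tmul, TensorProduct.smul_tmul]
    _ = ∑ y, tensorPow u l j y ⊗ₜ[ℂ] ∑ m, T y m • tensorPow u k m i := by
        rw [Finset.sum_comm]
        simp only [TensorProduct.tmul_sum]
    _ = ∑ y, ∑ m, T m i • (tensorPow u l j y ⊗ₜ[ℂ] tensorPow u l y m) := by
        simp only [hT, TensorProduct.tmul_sum, TensorProduct.tmul_smul]
    _ = _ := Finset.sum_comm

theorem star_comulMatrix [StarRing A] [StarModule ℂ A] (hu : ∀ i j, star (u i j) = u i j)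
    (i j : V) : star (comulMatrix u i j) = comulMatrix u i j := by
  simp [comulMatrix, star_sum, TensorProduct.star_tmul, hu]

end Comul

namespace FreeStarAlgebra

variable {V B : Type} [Ring B] [Algebra ℂ B] (w : Matrix V V B)

/-- The homomorphism from the free algebra determined by a matrix. -/
def lift : FreeStarAlgebra V →ₐ[ℂ] B :=
  MonoidAlgebra.lift ℂ B _ (FreeMonoid.lift fun p : V × V => w p.1 p.2)

theorem lift_gens : (gens V).map (lift w) = w := by
  ext i j
  simp [lift, gens]

theorem lift_star [StarRing B] [StarModule ℂ B] (hw : ∀ i j, star (w i j) = w i j)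
    (x : FreeStarAlgebra V) : lift w (star x) = star (lift w x) := by
  have h (m : FreeMonoid (V × V)) : FreeMonoid.lift (fun p : V × V => w p.1 p.2) (star m) =
      star (FreeMonoid.lift (fun p : V × V => w p.1 p.2) m) := by
    induction m using FreeMonoid.inductionOn with
    | one => simp
    | of p => simp [hw]
    | mul x y hx hy => rw [star_mul, map_mul, map_mul, star_mul, hx, hy]
  induction x using MonoidAlgebra.induction_linear with
  | zero => simp
  | add x y hx hy => rw [star_add, map_add, map_add, star_add, hx, hy]
  | single m c =>
    refine (congrArg (lift w) (monoidAlgebraStar_single _ _ _)).trans ?_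
    rw [lift, MonoidAlgebra.lift_single, MonoidAlgebra.lift_single, star_smul]
    exact congrArg _ (h m)

theorem adjoin_gens :
    Algebra.adjoin ℂ (Set.range fun p : V × V => gens V p.1 p.2) = ⊤ := by
  rw [eq_top_iff]
  rintro x -
  induction x using MonoidAlgebra.induction_on with
  | of m =>
    induction m using FreeMonoid.inductionOn with
    | one => rw [map_one]; exact Subalgebra.one_mem _
    | of p => exact Algebra.subset_adjoin ⟨p, rfl⟩
    | mul x y hx hy => rw [map_mul]; exact Subalgebra.mul_mem _ hx hy
  | add x y hx hy => exact Subalgebra.add_mem _ hx hy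
  | smul c x hx => exact Subalgebra.smul_mem _ hx c

end FreeStarAlgebra

namespace AssociatedAlgebra

variable (G : LoopGraph) (C : GraphCategory)

theorem adjoin_associatedMatrix :
    Algebra.adjoin ℂ (Set.range fun p : G.V × G.V => associatedMatrix G C p.1 p.2) = ⊤ := by
  have h := congrArg (Subalgebra.map (RingQuot.mkAlgHom ℂ (AssociatedRel G C)))
    (FreeStarAlgebra.adjoin_gens (V := G.V))
  rw [AlgHom.map_adjoin, ← Set.range_comp, Algebra.map_top,
    (AlgHom.range_eq_top _).2 (RingQuot.mkAlgHom_surjective ℂ _)] at h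
  exact h

theorem homMatrices_subset_intertwiners (k l : ℕ) :
    homMatrices G C k l ⊆ intertwiners (associatedMatrix G C) k l := by
  rintro _ ⟨K, hK, rfl⟩
  rw [mem_intertwiners_iff]
  intro j i
  have h := RingQuot.mkAlgHom_rel ℂ (AssociatedRel.intertwine (G := G) (C := C) K hK j i)
  simp only [Matrix.mul_apply, Matrix.map_apply, ← Algebra.commutes, ← Algebra.smul_def,
    map_sum, map_smul] at h
  have e {n : ℕ} (j i : Fin n → G.V) := tensorPow_map
    (RingQuot.mkAlgHom ℂ (AssociatedRel G C) : _ →+* AssociatedAlgebra G C)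
    (FreeStarAlgebra.gens G.V) j i
  simp only [AlgHom.coe_toRingHom] at e
  simp only [associatedMatrix, e]
  exact h

variable {G C} {B : Type} [Ring B] [Algebra ℂ B] [StarRing B] [StarModule ℂ B]
  {w : Matrix G.V G.V B}

/-- The universal property. -/
theorem exists_lift (hs : ∀ i j, star (w i j) = w i j)
    (hw : ∀ k l, homMatrices G C k l ⊆ intertwiners w k l) :
    ∃ f : AssociatedAlgebra G C →⋆ₐ[ℂ] B, ∀ i j, f (associatedMatrix G C i j) = w i j := by
  have hrel : ∀ ⦃x y⦄, AssociatedRel G C x y →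
      FreeStarAlgebra.lift w x = FreeStarAlgebra.lift w y := by
    intro x y h
    induction h with
    | @intertwine k l K hK j i =>
      have h := mem_intertwiners_iff.1 (hw k l ⟨K, hK, rfl⟩) j i
      have e {n : ℕ} (j i : Fin n → G.V) := tensorPow_map
        (FreeStarAlgebra.lift w : _ →+* B) (FreeStarAlgebra.gens G.V) j i
      simp only [AlgHom.coe_toRingHom, FreeStarAlgebra.lift_gens] at e
      simp only [Matrix.mul_apply, Matrix.map_apply, ← Algebra.commutes, ← Algebra.smul_def,
        map_sum, map_smul, ← e]
      exact h
    | adjoint _ ih => rw [FreeStarAlgebra.lift_star w hs, FreeStarAlgebra.lift_star w hs, ih]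
  let f : AssociatedAlgebra G C →ₐ[ℂ] B := RingQuot.liftAlgHom ℂ ⟨FreeStarAlgebra.lift w, hrel⟩
  have hf (x : FreeStarAlgebra G.V) :
      f (RingQuot.mkAlgHom ℂ (AssociatedRel G C) x) = FreeStarAlgebra.lift w x :=
    RingQuot.liftAlgHom_mkAlgHom_apply ℂ _ hrel x
  refine ⟨{ f with map_star' := fun x => ?_ }, fun i j => ?_⟩
  · obtain ⟨x, rfl⟩ := RingQuot.mkAlgHom_surjective ℂ (AssociatedRel G C) x
    rw [← mkAlgHom_star]
    exact (hf _).trans ((FreeStarAlgebra.lift_star w hs x).trans (congrArg star (hf x).symm))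
  · exact (hf _).trans (congrFun (congrFun (FreeStarAlgebra.lift_gens w) i) j)

end AssociatedAlgebra

/-! ### The semidirect product -/

section Semidirect

variable {V Γ : Type} [DecidableEq V] [Group Γ] {g : V → Γ}
  (H : Subgroup (Equiv.Perm V))

theorem semidirectMatrix_mul (i j i' j' : V) :
    semidirectMatrix g H i j * semidirectMatrix g H i' j' =
      MonoidAlgebra.of ℂ Γ (g i * g i') ⊗ₜ[ℂ] fun σ : H =>
        if i = (σ : Equiv.Perm V) j ∧ i' = (σ : Equiv.Perm V) j' then (1 : ℂ) else 0 := by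
  simp only [semidirectMatrix, Matrix.of_apply, Algebra.TensorProduct.tmul_mul_tmul, map_mul]
  congr 1
  ext σ
  simp [← ite_and, and_comm]

theorem star_semidirectMatrix (hg : ∀ v, g v * g v = 1) (i j : V) :
    star (semidirectMatrix g H i j) = semidirectMatrix g H i j := by
  simp only [semidirectMatrix, Matrix.of_apply, TensorProduct.star_tmul]
  congr 1
  · refine (monoidAlgebraStar_single _ _ _).trans ?_
    rw [MonoidAlgebra.of_apply, star_one, inv_eq_of_mul_eq_one_left (hg i)]
  · ext σ
    simp [apply_ite]

theorem semidirectMatrix_mul_transpose [Fintype V] (hg : ∀ v, g v * g v = 1) :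
    semidirectMatrix g H * (semidirectMatrix g H).transpose = 1 := by
  ext i j
  simp only [Matrix.mul_apply, Matrix.transpose_apply, semidirectMatrix_mul,
    ← TensorProduct.tmul_sum, Matrix.one_apply]
  split_ifs with h
  · subst h
    rw [hg, map_one, Algebra.TensorProduct.one_def]
    congr 1
    ext σ
    simp only [and_self, Finset.sum_apply, Pi.one_apply, ← Equiv.symm_apply_eq]
    simp
  · refine (congrArg _ ?_).trans (TensorProduct.tmul_zero _ _)
    ext σ
    rw [Finset.sum_apply]
    refine Finset.sum_eq_zero fun k _ => if_neg ?_
    rintro ⟨rfl, rfl⟩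
    exact h rfl

theorem semidirectMatrix_transpose_mul [Fintype V] (hg : ∀ v, g v * g v = 1) :
    (semidirectMatrix g H).transpose * semidirectMatrix g H = 1 := by
  ext i j
  simp only [Matrix.mul_apply, Matrix.transpose_apply, semidirectMatrix_mul, hg, map_one,
    ← TensorProduct.tmul_sum, Matrix.one_apply]
  split_ifs with h
  · subst h
    rw [Algebra.TensorProduct.one_def]
    congr 1
    ext σ
    simp
  · refine (congrArg _ ?_).trans (TensorProduct.tmul_zero _ _)
    ext σ
    rw [Finset.sum_apply]
    refine Finset.sum_eq_zero fun k _ => if_neg ?_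
    rintro ⟨rfl, h'⟩
    exact h ((σ : Equiv.Perm V).injective h')

/-- Row sums give γ_i ⊗ 1, squares give 1 ⊗ v_{ij}, and the product of the v_{σ(j)j} over all j is
the indicator function of σ. -/
theorem adjoin_semidirectMatrix [Fintype V] (hg : ∀ v, g v * g v = 1)
    (hgen : ∀ x : Γ, ∃ (k : ℕ) (a : Fin k → V), (List.ofFn fun m => g (a m)).prod = x) :
    Algebra.adjoin ℂ (Set.range fun p : V × V => semidirectMatrix g H p.1 p.2) = ⊤ := by
  classical
  have : Fintype H := Fintype.ofFinite H
  set S := Algebra.adjoin ℂ (Set.range fun p : V × V => semidirectMatrix g H p.1 p.2) with hS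
  have hu (i j : V) : semidirectMatrix g H i j ∈ S := Algebra.subset_adjoin ⟨(i, j), rfl⟩
  have hγ (i : V) : MonoidAlgebra.of ℂ Γ (g i) ⊗ₜ[ℂ] (1 : H → ℂ) ∈ S := by
    have h := Subalgebra.sum_mem S fun j (_ : j ∈ Finset.univ) => hu i j
    simp only [semidirectMatrix, Matrix.of_apply, ← TensorProduct.tmul_sum] at h
    convert h using 2
    ext σ
    simp only [Finset.sum_apply, Pi.one_apply, ← Equiv.symm_apply_eq]
    simp
  have hleft (x : MonoidAlgebra ℂ Γ) : x ⊗ₜ[ℂ] (1 : H → ℂ) ∈ S := by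
    change x ∈ S.comap Algebra.TensorProduct.includeLeft
    induction x using MonoidAlgebra.induction_on with
    | of x =>
      obtain ⟨k, a, rfl⟩ := hgen x
      rw [map_list_prod]
      refine Subalgebra.list_prod_mem _ fun y hy => ?_
      rw [List.map_ofFn] at hy
      obtain ⟨m, rfl⟩ := List.mem_ofFn.1 hy
      exact hγ _
    | add x y hx hy => exact Subalgebra.add_mem _ hx hy
    | smul c x hx => exact Subalgebra.smul_mem _ hx c
  have hv (i j : V) : (fun σ : H => if i = (σ : Equiv.Perm V) j then (1 : ℂ) else 0) ∈
      S.comap Algebra.TensorProduct.includeRight := by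
    have h := Subalgebra.mul_mem S (hu i j) (hu i j)
    simp only [semidirectMatrix_mul, hg, map_one, and_self] at h
    exact h
  have hδ (σ : H) : (Pi.single σ 1 : H → ℂ) ∈ S.comap Algebra.TensorProduct.includeRight := by
    have h := Subalgebra.prod_mem _ fun j (_ : j ∈ Finset.univ) => hv ((σ : Equiv.Perm V) j) j
    convert h using 1
    ext τ
    rw [Finset.prod_apply, Finset.prod_ite_zero, Pi.single_apply]
    have e : τ = σ ↔ ∀ j ∈ Finset.univ, (σ : Equiv.Perm V) j = (τ : Equiv.Perm V) j :=
      ⟨fun h j _ => by rw [h], fun h => Subtype.ext (Equiv.ext fun j => (h j (by simp)).symm)⟩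
    simp [e]
  have hright (f : H → ℂ) : (1 : MonoidAlgebra ℂ Γ) ⊗ₜ[ℂ] f ∈ S := by
    change f ∈ S.comap Algebra.TensorProduct.includeRight
    rw [pi_eq_sum_univ' f]
    refine Subalgebra.sum_mem _ fun σ _ => Subalgebra.smul_mem _ ?_ _
    convert hδ σ using 1
  rw [eq_top_iff]
  rintro x -
  induction x using TensorProduct.induction_on with
  | zero => exact Subalgebra.zero_mem _
  | tmul x f =>
    have h := Subalgebra.mul_mem S (hleft x) (hright f)
    rwa [Algebra.TensorProduct.tmul_mul_tmul, mul_one, one_mul] at h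
  | add x y hx hy => exact Subalgebra.add_mem _ hx hy

end Semidirect

end

/-! ### The main theorem -/

theorem mainTheorem3 (G : LoopGraph) (F : GraphFibration) (hF : F.IsEasy) (hG : F.Mem G) :
    IsAssociatedCMQG G (F.category hF).toGraphCategory
        (semidirectMatrix
          (fun v => (FreeZ2.gen v : FreeZ2 G.V ⧸ F.fibreSubgroup G hG)) G.autGroup) ∧
      ∃ e : AssociatedAlgebra G (F.category hF).toGraphCategory ≃⋆ₐ[ℂ]
          MonoidAlgebra ℂ (FreeZ2 G.V ⧸ F.fibreSubgroup G hG) ⊗[ℂ] (G.autGroup → ℂ),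
        ∀ i j, e (associatedMatrix G (F.category hF).toGraphCategory i j) =
          semidirectMatrix
            (fun v => (FreeZ2.gen v : FreeZ2 G.V ⧸ F.fibreSubgroup G hG)) G.autGroup i j := by
  have : Fintype G.autGroup := Fintype.ofFinite _
  set C := (F.category hF).toGraphCategory with hC
  set g : G.V → FreeZ2 G.V ⧸ F.fibreSubgroup G hG := fun v => (FreeZ2.gen v : FreeZ2 G.V) with hgdef
  have hg (v : G.V) : g v * g v = 1 := by
    rw [hgdef]
    exact congrArg _ (FreeZ2.gen_mul_self v)
  have hgen (x : FreeZ2 G.V ⧸ F.fibreSubgroup G hG) :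
      ∃ (k : ℕ) (a : Fin k → G.V), (List.ofFn fun m => g (a m)).prod = x := by
    induction x using QuotientGroup.induction_on with
    | H x =>
      obtain ⟨k, a, rfl⟩ := FreeZ2.exists_word x
      exact ⟨k, a, prod_ofFn_mk_gen _ a⟩
  have hspan (k l : ℕ) : intertwiners (semidirectMatrix g G.autGroup) k l =
      (Submodule.span ℂ (homMatrices G C k l) : Set _) := by
    rw [hC, span_homMatrices hF hG]
    exact GraphFibration.intertwiners_semidirectMatrix hG k l
  have hsub (k l : ℕ) : homMatrices G C k l ⊆ intertwiners (semidirectMatrix g G.autGroup) k l := by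
    rw [hspan]
    exact Submodule.subset_span
  have hadj := adjoin_semidirectMatrix G.autGroup hg hgen
  obtain ⟨f, hf⟩ := AssociatedAlgebra.exists_lift (star_semidirectMatrix G.autGroup hg) hsub
  -- The comultiplication is first defined on the universal algebra, and transported along the
  -- isomorphism at the end.
  obtain ⟨d, hd⟩ := AssociatedAlgebra.exists_lift
    (star_comulMatrix _ (star_semidirectMatrix G.autGroup hg))
    fun k l => (hsub k l).trans (intertwiners_subset_comulMatrix _ k l)
  -- The defining relations extend linearly to the span, which consists of all admissible matrices.
  have hw : IntertwinesAdmissible F G (associatedMatrix G C) := fun k l => by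
    rw [← span_homMatrices hF hG]
    exact Submodule.span_le (p := intertwinerSubmodule _ k l).2
      (AssociatedAlgebra.homMatrices_subset_intertwiners G C k l)
  have hB := AssociatedAlgebra.adjoin_associatedMatrix G C
  have hbij : Function.Bijective f := by
    constructor
    -- Injectivity: `semidirectHom` is a left inverse, as can be checked on generators.
    · have h : (IntertwinesAdmissible.semidirectHom hG hw hB).comp f.toAlgHom = AlgHom.id ℂ _ := by
        refine AlgHom.ext_of_adjoin_eq_top hB ?_
        rintro _ ⟨p, rfl⟩
        exact (congrArg _ (hf p.1 p.2)).trans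
          (IntertwinesAdmissible.semidirectHom_semidirectMatrix hG hw hB p.1 p.2)
      exact Function.LeftInverse.injective fun x => DFunLike.congr_fun h x
    · refine (AlgHom.range_eq_top f.toAlgHom).1 (top_le_iff.1 (hadj.ge.trans ?_))
      refine Algebra.adjoin_le ?_
      rintro _ ⟨p, rfl⟩
      exact ⟨_, hf p.1 p.2⟩
  let e := StarAlgEquiv.ofBijective f hbij
  have he (i j : G.V) : e (associatedMatrix G C i j) = semidirectMatrix g G.autGroup i j := hf i j
  refine ⟨⟨⟨?_, star_semidirectMatrix G.autGroup hg, semidirectMatrix_mul_transpose G.autGroup hg,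
    semidirectMatrix_transpose_mul G.autGroup hg, d.comp (e.symm : _ →⋆ₐ[ℂ] _), fun i j => ?_⟩,
    hspan⟩, e, he⟩
  · rw [eq_top_iff]
    intro x _
    have hx : x ∈ Algebra.adjoin ℂ
        (Set.range fun p : G.V × G.V => semidirectMatrix g G.autGroup p.1 p.2) := by
      rw [hadj]; trivial
    exact Algebra.adjoin_le (StarAlgebra.subset_adjoin ℂ _) hx
  · change d (e.symm (semidirectMatrix g G.autGroup i j)) = _
    rw [← he, e.symm_apply_apply, hd]
    rfl
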